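/- Let $\Bbbk$ be a commutative ring and let $\mathcal B=(\mathcal B,\otimes,\mathbb 1)$ be a $\Bbbk$-linear monoidal category (the Hom sets are $\Bbbk$-modules, and composition and $\otimes$ of morphisms are $\Bbbk$-bilinear) with a braiding $c_{X,Y}\colon X\otimes Y\to Y\otimes X$ and a twist $\theta$, that is, a natural automorphism of $\mathrm{id}_{\mathcal B}$ with $\theta_{X\otimes Y}=(\theta_X\otimes\theta_Y)\,c_{Y,X}\,c_{X,Y}$ for all $X,Y$. Associativity and unit constraints are suppressed. Let $H=(H,m,u,\Delta,\varepsilon,S)$ be a Hopf algebra in $\mathcal B$ with invertible antipode $S$, the bialgebra axiom being $\Delta m=(m\otimes m)(\mathrm{id}_H\otimes c_{H,H}\otimes\mathrm{id}_H)(\Delta\otimes\Delta)$. Let $(\delta,\sigma)$ be a $\theta$-twisted modular pair in involution for $H$: $\delta\colon H\to\mathbb 1$ is an algebra morphism, $\sigma\colon\mathbb 1\to H$ is a coalgebra morphism, $\delta\sigma=\mathrm{id}_{\mathbb 1}$, and $$S^2=m(m\otimes\mathrm{id}_H)(\sigma\otimes\theta_H\otimes S\sigma)(\delta S\otimes\mathrm{id}_H\otimes\delta)(\Delta\otimes\mathrm{id}_H)\Delta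 .$$ Put $\mathbf{CM}_n(H,\delta,\sigma)=H^{\otimes n}$ for $n\ge 0$, with the following operators. * Cofaces $\delta_i^n\colon H^{\otimes n-1}\to H^{\otimes n}$ for $n\ge1$, $0\le i\le n$: $\delta_0^n=u\otimes\mathrm{id}$; $\delta_i^n$ applies $\Delta$ to the $i$-th factor for $1\le i\le n-1$; $\delta_n^n=\mathrm{id}\otimes\sigma$. * Codegeneracies $\sigma_j^n\colon H^{\otimes n+1}\to H^{\otimes n}$ for $0\le j\le n$: $\sigma_j^n$ applies $\varepsilon$ to the $(j+1)$-st factor. * Operators $\tau_n\colon H^{\otimes n}\to H^{\otimes n}$: $\tau_0=\mathrm{id}_{\mathbb 1}$ and $\tau_n=a_n(\tilde S\otimes\mathrm{id}_{H^{\otimes n-1}}\otimes\sigma)$ for $n\ge1$. Here $\tilde S=(\delta\otimes S)\Delta$, and $a_n\colon H\otimes H^{\otimes n}\to H^{\otimes n}$ is the left diagonal action: $a_0=\varepsilon$ and $a_{n+1}=(m\otimes a_n)(\mathrm{id}_H\otimes c_{H,H}\otimes\mathrm{id}_{H^{\otimes n}})(\Delta\otimes\mathrm{id}_{H^{\otimes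 n+1}})$. The cyclic category $\Delta C$ has the nonnegative integers as objects. Its morphisms are generated by cofaces $\delta_i^n\colon n-1\to n$ ($n\ge1$, $0\le i\le n$), codegeneracies $\sigma_j^n\colon n+1\to n$ ($n\ge 0$, $0\le j\le n$) and isomorphisms $\tau_n\colon n\to n$ ($n\ge 0$), subject to the cosimplicial identities $$\delta_j\delta_i=\delta_i\delta_{j-1}\ (i<j),\qquad \sigma_j\sigma_i=\sigma_i\sigma_{j+1}\ (i\le j),$$ $$\sigma_j\delta_i=\delta_i\sigma_{j-1}\ (i<j),\qquad \sigma_j\delta_i=\mathrm{id}\ (i=j,\,j+1),\qquad \sigma_j\delta_i=\delta_{i-1}\sigma_j\ (i>j+1),$$ to the relations $\tau_n\delta_i=\delta_{i-1}\tau_{n-1}$ and $\tau_n\sigma_i=\sigma_{i-1}\tau_{n+1}$ for $1\le i\le n$, $\tau_n\delta_0=\delta_n$, $\tau_n\sigma_0=\sigma_n\tau_{n+1}^2$, and to $\tau_n^{n+1}=\mathrm{id}_n$. A cocyclic (respectively cyclic) $\Bbbk$-module is a functor from $\Delta C$ (respectively $\Delta C^{\mathrm{op}}$) to $\mathbf{Mod}_{\Bbbk}$.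 Then: (a) the $\Bbbk$-modules $\mathrm{Hom}_{\mathcal B}(\mathbb 1,\mathbf{CM}_n(H,\delta,\sigma))$, $n\ge0$, with the operators given by postcomposition with $\delta_i^n,\sigma_j^n,\tau_n$, form a cocyclic $\Bbbk$-module; (b) the $\Bbbk$-modules $\mathrm{Hom}_{\mathcal B}(\mathbf{CM}_n(H,\delta,\sigma),\mathbb 1)$, $n\ge0$, with the operators given by precomposition with $\delta_i^n,\sigma_j^n,\tau_n$, form a cyclic $\Bbbk$-module. -/

import Mathlib

open CategoryTheory MonoidalCategory Opposite
open scoped MonObj ComonObj HopfObj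

universe w v u

/-! ### The cyclic category by generators and relations -/

/-- The objects of the cyclic category: the nonnegative integers. -/
def CyclicQuiver : Type := ℕ

/-- The generating morphisms of the cyclic category: the cofaces
`δ_i : n → n + 1` for `0 ≤ i ≤ n + 1`, the codegeneracies `σ_j : n + 1 → n` for `0 ≤ j ≤ n`
and the cocyclic operators `τ_n : n → n`. -/
inductive CyclicQuiver.Gen : ℕ → ℕ → Type
  | coface (n i : ℕ) (hi : i ≤ n + 1) : CyclicQuiver.Gen n (n + 1)
  | codegeneracy (n j : ℕ) (hj : j ≤ n) : CyclicQuiver.Gen (n + 1) n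
  | cocyclic (n : ℕ) : CyclicQuiver.Gen n n

instance : Quiver CyclicQuiver where
  Hom n m := CyclicQuiver.Gen n m

namespace CyclicQuiver

/-- The object `n` in the free category on the generators. -/
abbrev ob (n : ℕ) : Paths CyclicQuiver := (Paths.of CyclicQuiver).obj n

/-- The coface `δ_i : n → n + 1` in the free category on the generators. -/
def d (n i : ℕ) (hi : i ≤ n + 1) : ob n ⟶ ob (n + 1) :=
  (Paths.of CyclicQuiver).map (Gen.coface n i hi)

/-- The codegeneracy `σ_j : n + 1 → n` in the free category on the generators. -/
def s (n j : ℕ) (hj : j ≤ n) : ob (n + 1) ⟶ ob n :=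
  (Paths.of CyclicQuiver).map (Gen.codegeneracy n j hj)

/-- The cocyclic operator `τ_n : n → n` in the free category on the generators. -/
def t (n : ℕ) : ob n ⟶ ob n :=
  (Paths.of CyclicQuiver).map (Gen.cocyclic n)

/-- The `m`-th power of the cocyclic operator `τ_n`. -/
def tPow (n : ℕ) : ℕ → (ob n ⟶ ob n)
  | 0 => 𝟙 _
  | m + 1 => tPow n m ≫ t n

/-- The defining relations of the cyclic category: the simplicial relations, the
paracyclic compatibility relations and the cyclicity condition. Recall that `f ≫ g` is `g ∘ f`. -/
inductive Rel : HomRel (Paths CyclicQuiver)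
  -- `δ_j δ_i = δ_i δ_{j-1}` for `i < j`
  | coface_coface (n i j : ℕ) (hij : i < j) (hj : j ≤ n + 2) :
      Rel (d n i (by omega) ≫ d (n + 1) j hj)
        (d n (j - 1) (by omega) ≫ d (n + 1) i (by omega))
  -- `σ_j σ_i = σ_i σ_{j+1}` for `i ≤ j`
  | codegeneracy_codegeneracy (n i j : ℕ) (hij : i ≤ j) (hj : j ≤ n) :
      Rel (s (n + 1) i (by omega) ≫ s n j hj)
        (s (n + 1) (j + 1) (by omega) ≫ s n i (by omega))
  -- `σ_j δ_i = δ_i σ_{j-1}` for `i < j`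
  | coface_codegeneracy_of_lt (n i j : ℕ) (hij : i < j) (hj : j ≤ n + 1) :
      Rel (d (n + 1) i (by omega) ≫ s (n + 1) j hj)
        (s n (j - 1) (by omega) ≫ d n i (by omega))
  -- `σ_j δ_j = id`
  | coface_codegeneracy_self (n j : ℕ) (hj : j ≤ n) :
      Rel (d n j (by omega) ≫ s n j hj) (𝟙 _)
  -- `σ_j δ_{j+1} = id`
  | coface_codegeneracy_succ (n j : ℕ) (hj : j ≤ n) :
      Rel (d n (j + 1) (by omega) ≫ s n j hj) (𝟙 _)
  -- `σ_j δ_i = δ_{i-1} σ_j` for `i > j + 1`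
  | coface_codegeneracy_of_gt (n i j : ℕ) (hij : j + 1 < i) (hi : i ≤ n + 2) :
      Rel (d (n + 1) i hi ≫ s (n + 1) j (by omega))
        (s n j (by omega) ≫ d n (i - 1) (by omega))
  -- `τ_n δ_i = δ_{i-1} τ_{n-1}` for `1 ≤ i ≤ n`
  | coface_cocyclic (n i : ℕ) (hi : 1 ≤ i) (hi' : i ≤ n + 1) :
      Rel (d n i hi' ≫ t (n + 1)) (t n ≫ d n (i - 1) (by omega))
  -- `τ_n δ_0 = δ_n`
  | coface_zero_cocyclic (n : ℕ) :
      Rel (d n 0 (by omega) ≫ t (n + 1)) (d n (n + 1) le_rfl)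
  -- `τ_n σ_i = σ_{i-1} τ_{n+1}` for `1 ≤ i ≤ n`
  | codegeneracy_cocyclic (n i : ℕ) (hi : 1 ≤ i) (hi' : i ≤ n) :
      Rel (s n i hi' ≫ t n) (t (n + 1) ≫ s n (i - 1) (by omega))
  -- `τ_n σ_0 = σ_n τ_{n+1}²`
  | codegeneracy_zero_cocyclic (n : ℕ) :
      Rel (s n 0 (by omega) ≫ t n) (t (n + 1) ≫ t (n + 1) ≫ s n n le_rfl)
  -- `τ_n ^ (n + 1) = id`
  | cocyclic_pow (n : ℕ) : Rel (tPow n (n + 1)) (𝟙 _)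

end CyclicQuiver

/-- The cyclic category `ΔC`: the category generated by the cofaces, the codegeneracies and the
cocyclic operators, subject to the relations `CyclicQuiver.Rel`. -/
abbrev CyclicCategory : Type := CategoryTheory.Quotient CyclicQuiver.Rel

/-- The generators, seen in the cyclic category. -/
def CyclicCategory.gen : CyclicQuiver ⥤q CyclicCategory :=
  Paths.of CyclicQuiver ⋙q (CategoryTheory.Quotient.functor CyclicQuiver.Rel).toPrefunctor

/-- A family of objects `D_n` of `C`, with morphisms `δ_i : D_n ⟶ D_{n+1}`,
`σ_j : D_{n+1} ⟶ D_n` and `τ_n : D_n ⟶ D_n`, *is a cocyclic object* of `C` when it is the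
restriction to the generators of a functor `ΔC ⥤ C`. -/
def IsCocyclicObject {C : Type u} [Category.{v} C] (D : CyclicQuiver ⥤q C) : Prop :=
  ∃ Y : CyclicCategory ⥤ C, CyclicCategory.gen ⋙q Y.toPrefunctor = D

/-- A family of objects `D_n` of `C`, with morphisms `δ_i : D_{n+1} ⟶ D_n`,
`σ_j : D_n ⟶ D_{n+1}` and `τ_n : D_n ⟶ D_n` (that is, a prefunctor from the generators to `Cᵒᵖ`),
*is a cyclic object* of `C` when it is the restriction to the generators of a functor
`ΔCᵒᵖ ⥤ C`. -/
def IsCyclicObject {C : Type u} [Category.{v} C] (D : CyclicQuiver ⥤q Cᵒᵖ) : Prop :=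
  ∃ X : CyclicCategoryᵒᵖ ⥤ C, CyclicCategory.gen ⋙q X.rightOp.toPrefunctor = D

section Braided

variable {B : Type u} [Category.{v} B] [MonoidalCategory B] [BraidedCategory B]

/-! ### Twists and modular pairs -/

variable (B) in
/-- A twist of a braided monoidal category: a natural automorphism `θ` of the identity functor
such that `θ_{X ⊗ Y} = (θ_X ⊗ θ_Y) τ_{Y,X} τ_{X,Y}`, where `τ` is the braiding. -/
structure BraidedTwist where
  /-- The natural automorphism of the identity functor. -/
  iso : 𝟭 B ≅ 𝟭 B
  app_tensor (X Y : B) : iso.hom.app (X ⊗ Y) =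
    (β_ X Y).hom ≫ (β_ Y X).hom ≫ (iso.hom.app X ⊗ₘ iso.hom.app Y)

/-- The component `θ_X : X ⟶ X` of a twist. -/
def BraidedTwist.app (θ : BraidedTwist B) (X : B) : X ⟶ X := θ.iso.hom.app X

/-- A modular pair for `H`: an algebra morphism `δ : H ⟶ 𝟙` and a coalgebra morphism
`σ : 𝟙 ⟶ H` such that `δ σ = id`. -/
structure IsModularPair (H : B) [HopfObj H] (δ : H ⟶ 𝟙_ B) (σ : 𝟙_ B ⟶ H) : Prop where
  mul_character : μ[H] ≫ δ = (δ ⊗ₘ δ) ≫ (λ_ (𝟙_ B)).hom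
  one_character : η[H] ≫ δ = 𝟙 (𝟙_ B)
  grouplike_comul : σ ≫ Δ[H] = (λ_ (𝟙_ B)).inv ≫ (σ ⊗ₘ σ)
  grouplike_counit : σ ≫ ε[H] = 𝟙 (𝟙_ B)
  grouplike_character : σ ≫ δ = 𝟙 (𝟙_ B)

/-- The morphism `h ↦ δ(S(h₁)) h₂ δ(h₃)` from `H` to `H` (Sweedler notation). -/
def coconjugation (H : B) [HopfObj H] (δ : H ⟶ 𝟙_ B) : H ⟶ H :=
  Δ[H] ≫ (𝒮[H] ≫ δ) ▷ H ≫ (λ_ H).hom ≫ Δ[H] ≫ H ◁ δ ≫ (ρ_ H).hom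

/-- The morphism `h ↦ σ h S(σ)` from `H` to `H`. -/
def conjugation (H : B) [HopfObj H] (σ : 𝟙_ B ⟶ H) : H ⟶ H :=
  (λ_ H).inv ≫ σ ▷ H ≫ μ[H] ≫ (ρ_ H).inv ≫ H ◁ (σ ≫ 𝒮[H]) ≫ μ[H]

/-- A `θ`-twisted modular pair in involution for `H`: a modular pair `(δ, σ)` such that
`S²(h) = δ(S(h₁)) σ θ(h₂) S(σ) δ(h₃)` in Sweedler notation. -/
structure IsTwistedModularPairInInvolution (θ : BraidedTwist B) (H : B) [HopfObj H]
    (δ : H ⟶ 𝟙_ B) (σ : 𝟙_ B ⟶ H) : Prop extends IsModularPair H δ σ where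
  antipode_sq : 𝒮[H] ≫ 𝒮[H] = coconjugation H δ ≫ θ.app H ≫ conjugation H σ

/-! ### The braided Connes-Moscovici construction -/

namespace ConnesMoscovici

/-- The tensor power `H^{⊗ n}`, bracketed as `H ⊗ (H ⊗ ⋯ (H ⊗ 𝟙))`. -/
def tensorPow (H : B) : ℕ → B
  | 0 => 𝟙_ B
  | n + 1 => H ⊗ tensorPow H n

variable (H : B) [HopfObj H] (δ : H ⟶ 𝟙_ B) (σ : 𝟙_ B ⟶ H)

/-- The morphism `id ⊗ σ : H^{⊗ n} ⟶ H^{⊗ (n + 1)}`, which inserts `σ` at the last place. -/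
def insertLast : (n : ℕ) → (tensorPow H n ⟶ tensorPow H (n + 1))
  | 0 => (ρ_ (𝟙_ B)).inv ≫ σ ▷ 𝟙_ B
  | n + 1 => H ◁ insertLast n

/-- The left diagonal action `H ⊗ H^{⊗ n} ⟶ H^{⊗ n}`: it is the counit for `n = 0`, and
`(m ⊗ act_n) (id_H ⊗ τ_{H,H} ⊗ id) (Δ ⊗ id)` on `H ⊗ (H ⊗ H^{⊗ n})`. -/
def diagonalAction : (n : ℕ) → (H ⊗ tensorPow H n ⟶ tensorPow H n)
  | 0 => ε[H] ▷ 𝟙_ B ≫ (λ_ (𝟙_ B)).hom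
  | n + 1 => Δ[H] ▷ (H ⊗ tensorPow H n) ≫ tensorμ H H H (tensorPow H n) ≫
      (μ[H] ⊗ₘ diagonalAction n)

/-- The twisted antipode `h ↦ δ(h₁) S(h₂)`. -/
def twistedAntipode : H ⟶ H :=
  Δ[H] ≫ δ ▷ H ≫ (λ_ H).hom ≫ 𝒮[H]

/-- The coface `δ_i : H^{⊗ n} ⟶ H^{⊗ (n + 1)}`, for `0 ≤ i ≤ n + 1`: it inserts the unit at the
first place for `i = 0`, comultiplies the `i`-th factor for `1 ≤ i ≤ n`, and inserts `σ` at the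
last place for `i = n + 1`. (The value for `i > n + 1` is irrelevant.) -/
def coface : (n i : ℕ) → (tensorPow H n ⟶ tensorPow H (n + 1))
  | n, 0 => (λ_ (tensorPow H n)).inv ≫ η[H] ▷ tensorPow H n
  | 0, _ + 1 => insertLast H σ 0
  | n + 1, 1 => Δ[H] ▷ tensorPow H n ≫ (α_ H H (tensorPow H n)).hom
  | n + 1, i + 2 => H ◁ coface n (i + 1)

/-- The codegeneracy `σ_j : H^{⊗ (n + 1)} ⟶ H^{⊗ n}`, for `0 ≤ j ≤ n`: it applies the counit to
the `(j + 1)`-st factor. (The value for `j > n` is irrelevant.) -/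
def codegeneracy : (n j : ℕ) → (tensorPow H (n + 1) ⟶ tensorPow H n)
  | n, 0 => ε[H] ▷ tensorPow H n ≫ (λ_ (tensorPow H n)).hom
  | 0, _ + 1 => ε[H] ▷ 𝟙_ B ≫ (λ_ (𝟙_ B)).hom
  | n + 1, j + 1 => H ◁ codegeneracy n j

/-- The paracocyclic operator `τ_n(δ, σ) : H^{⊗ n} ⟶ H^{⊗ n}`: the identity for `n = 0`, and for
`n ≥ 1` the diagonal action of `S̃(h₁)` on `h₂ ⊗ ⋯ ⊗ hₙ ⊗ σ`. -/
def paracocyclic : (n : ℕ) → (tensorPow H n ⟶ tensorPow H n)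
  | 0 => 𝟙 _
  | n + 1 => (twistedAntipode H δ ⊗ₘ insertLast H σ n) ≫ diagonalAction H (n + 1)

/-- The morphism of `CM(H, δ, σ)` assigned to a generator. -/
def mapGen : {n m : ℕ} → CyclicQuiver.Gen n m → (tensorPow H n ⟶ tensorPow H m)
  | _, _, .coface n i _ => coface H σ n i
  | _, _, .codegeneracy n j _ => codegeneracy H n j
  | _, _, .cocyclic n => paracocyclic H δ σ n

/-- The family `CM_n(H, δ, σ) = H^{⊗ n}` of objects of `B`, together with its cofaces,
codegeneracies and paracocyclic operators. -/
def CM : CyclicQuiver ⥤q B where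
  obj n := tensorPow H n
  map f := mapGen H δ σ f

end ConnesMoscovici

end Braided

/-- The family `Hom(𝟙, D_n)` of `k`-modules, with the operators `f ↦ f ≫ D(g)`. -/
def homFromUnit (k : Type w) [CommRing k] {B : Type u} [Category.{v} B] [Preadditive B]
    [Linear k B] [MonoidalCategory B] (D : CyclicQuiver ⥤q B) : CyclicQuiver ⥤q ModuleCat.{v} k :=
  D ⋙q ((linearCoyoneda k B).obj (op (𝟙_ B))).toPrefunctor

/-- The family `Hom(D_n, 𝟙)` of `k`-modules, with the operators `f ↦ D(g) ≫ f`. -/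
def homToUnit (k : Type w) [CommRing k] {B : Type u} [Category.{v} B] [Preadditive B]
    [Linear k B] [MonoidalCategory B] (D : CyclicQuiver ⥤q B) :
    CyclicQuiver ⥤q (ModuleCat.{v} k)ᵒᵖ :=
  D ⋙q ((linearYoneda k B).obj (𝟙_ B)).rightOp.toPrefunctor

/-! The object `H^{⊗n}` plays the role of the δ-coinvariants of `H^{⊗(n+1)}` under the diagonal
action. The projection p_n(h ⊗ x) = S̃(h)·x (`coinvariantProjection`) satisfies p_n(h·y) = δ(h)
p_n(y) and is split by δ_0 = u ⊗ id; τ_n inserts σ at the end and then applies p_n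
(`paracocyclic_eq`). The inner cofaces and all codegeneracies are H-linear, so they commute with
these projections. This, semi-invariance and S̃(h₁)h₂ = δ(h)1 give every relation between τ and the
other operators except cyclicity.

For cyclicity, the involution condition yields S̃²(h)σ = σθ(h) (`twistedAntipode_sq`). Hence p_n
intertwines τ_n with the cyclic rotation of `H^{⊗(n+1)}` that applies h ↦ σθ(h) to the moving factor
(`coinvariantProjection_comp_paracocyclic`). By the twist axiom, n + 1 such rotations compose to θ
followed by the diagonal action of σ (`iter_rotation_twist`), and p_n absorbs σ because δσ = id.
Therefore τ_n^{n+1} = θ on `H^{⊗n}` (`iter_paracocyclic`).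

So in `B` only the last relation fails, and only by θ. Since θ is the identity on the unit object,
naturality makes it act trivially on Hom(𝟙, -) and Hom(-, 𝟙). -/

namespace ConnesMoscovici

variable {B : Type u} [Category.{v} B] [MonoidalCategory B]

/-! ### The operators on the first tensor factor -/

section Generic

lemma whiskerLeft_comp_eq_comp (H : B) {X Y Y' Z : B} {f : X ⟶ Y} {g : Y ⟶ Z} {f' : X ⟶ Y'}
    {g' : Y' ⟶ Z} (h : f ≫ g = f' ≫ g') : H ◁ f ≫ H ◁ g = H ◁ f' ≫ H ◁ g' := by
  rw [← whiskerLeft_comp, h, whiskerLeft_comp]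

lemma whiskerLeft_comp_eq_id (H : B) {X Y : B} {f : X ⟶ Y} {g : Y ⟶ X} (h : f ≫ g = 𝟙 X) :
    H ◁ f ≫ H ◁ g = 𝟙 (H ⊗ X) := by
  rw [← whiskerLeft_comp, h, whiskerLeft_id]

variable [BraidedCategory B] (H : B) [HopfObj H] {X Y : B}

/-- The second factor is arbitrary here and below: the operators on tensor powers unfold to these
shapes by definition, so the identities later apply through `exact`. -/
lemma unit_insertion_naturality (f : X ⟶ Y) :
    ((λ_ X).inv ≫ η[H] ▷ X) ≫ H ◁ f = f ≫ (λ_ Y).inv ≫ η[H] ▷ Y := by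
  rw [Category.assoc, ← whisker_exchange, leftUnitor_inv_naturality_assoc]

lemma counit_contraction_naturality (f : X ⟶ Y) :
    H ◁ f ≫ ε[H] ▷ Y ≫ (λ_ Y).hom = (ε[H] ▷ X ≫ (λ_ X).hom) ≫ f := by
  rw [whisker_exchange_assoc, leftUnitor_naturality, Category.assoc]

lemma comul_insertion_naturality (f : X ⟶ Y) :
    (Δ[H] ▷ X ≫ (α_ H H X).hom) ≫ H ◁ H ◁ f = H ◁ f ≫ Δ[H] ▷ Y ≫ (α_ H H Y).hom := by
  simp [whisker_exchange_assoc]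

variable (X)

lemma unit_insertion_comul :
    ((λ_ X).inv ≫ η[H] ▷ X) ≫ Δ[H] ▷ X ≫ (α_ H H X).hom =
      ((λ_ X).inv ≫ η[H] ▷ X) ≫ (λ_ (H ⊗ X)).inv ≫ η[H] ▷ (H ⊗ X) := by
  rw [Category.assoc, ← comp_whiskerRight_assoc, Bimon.one_comul, MonoidalCategory.tensorHom_def']
  monoidal

lemma grouplike_insertion_comul {σ : 𝟙_ B ⟶ H}
    (hσ : σ ≫ Δ[H] = (λ_ (𝟙_ B)).inv ≫ (σ ⊗ₘ σ)) :
    ((ρ_ (𝟙_ B)).inv ≫ σ ▷ 𝟙_ B) ≫ H ◁ ((ρ_ (𝟙_ B)).inv ≫ σ ▷ 𝟙_ B) =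
      ((ρ_ (𝟙_ B)).inv ≫ σ ▷ 𝟙_ B) ≫ Δ[H] ▷ 𝟙_ B ≫ (α_ H H (𝟙_ B)).hom := by
  rw [Category.assoc, Category.assoc, ← comp_whiskerRight_assoc, hσ,
    MonoidalCategory.tensorHom_def]
  monoidal

lemma comul_insertion_comul :
    (Δ[H] ▷ X ≫ (α_ H H X).hom) ≫ H ◁ (Δ[H] ▷ X ≫ (α_ H H X).hom) =
      (Δ[H] ▷ X ≫ (α_ H H X).hom) ≫ Δ[H] ▷ (H ⊗ X) ≫ (α_ H H (H ⊗ X)).hom := by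
  calc _ = (Δ[H] ≫ H ◁ Δ[H]) ▷ X ≫ (α_ H (H ⊗ H) X).hom ≫ H ◁ (α_ H H X).hom := by monoidal
    _ = _ := by rw [ComonObj.comul_assoc]; monoidal

lemma unit_insertion_counit :
    ((λ_ X).inv ≫ η[H] ▷ X) ≫ ε[H] ▷ X ≫ (λ_ X).hom = 𝟙 X := by
  rw [Category.assoc, ← comp_whiskerRight_assoc, BimonObj.one_counit]
  simp

lemma comul_insertion_counit :
    (Δ[H] ▷ X ≫ (α_ H H X).hom) ≫ ε[H] ▷ (H ⊗ X) ≫ (λ_ (H ⊗ X)).hom = 𝟙 (H ⊗ X) := by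
  calc _ = (Δ[H] ≫ ε[H] ▷ H) ▷ X ≫ (λ_ H).hom ▷ X := by monoidal
    _ = _ := by rw [ComonObj.counit_comul]; monoidal

lemma comul_insertion_whiskerLeft_counit :
    (Δ[H] ▷ X ≫ (α_ H H X).hom) ≫ H ◁ (ε[H] ▷ X ≫ (λ_ X).hom) = 𝟙 (H ⊗ X) := by
  calc _ = (Δ[H] ≫ H ◁ ε[H]) ▷ X ≫ (ρ_ H).hom ▷ X := by monoidal
    _ = _ := by rw [ComonObj.comul_counit]; monoidal

lemma grouplike_insertion_counit {σ : 𝟙_ B ⟶ H} (hσ : σ ≫ ε[H] = 𝟙 (𝟙_ B)) :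
    ((ρ_ (𝟙_ B)).inv ≫ σ ▷ 𝟙_ B) ≫ ε[H] ▷ 𝟙_ B ≫ (λ_ (𝟙_ B)).hom = 𝟙 (𝟙_ B) := by
  rw [Category.assoc, ← comp_whiskerRight_assoc, hσ]
  monoidal

end Generic

/-! ### The cosimplicial identities -/

section Cosimplicial

variable [BraidedCategory B] (H : B) [HopfObj H] (σ : 𝟙_ B ⟶ H)

lemma coface_zero (n : ℕ) :
    coface H σ n 0 = (λ_ (tensorPow H n)).inv ≫ η[H] ▷ tensorPow H n := by
  cases n <;> rfl

lemma coface_last (n : ℕ) : coface H σ n (n + 1) = insertLast H σ n := by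
  induction n with
  | zero => rfl
  | succ n ih => exact congrArg (H ◁ ·) ih

lemma codegeneracy_zero (n : ℕ) :
    codegeneracy H n 0 = ε[H] ▷ tensorPow H n ≫ (λ_ (tensorPow H n)).hom := by
  cases n <;> rfl

lemma coface_zero_naturality {n m : ℕ} (f : tensorPow H n ⟶ tensorPow H m) :
    coface H σ n 0 ≫ H ◁ f = f ≫ coface H σ m 0 := by
  rw [coface_zero, coface_zero]
  exact unit_insertion_naturality H f

lemma codegeneracy_zero_naturality {n m : ℕ} (f : tensorPow H n ⟶ tensorPow H m) :
    H ◁ f ≫ codegeneracy H m 0 = codegeneracy H n 0 ≫ f := by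
  rw [codegeneracy_zero, codegeneracy_zero]
  exact counit_contraction_naturality H f

variable {σ}

/-- Induction strips the first factor when both cofaces act beyond it. What remains is naturality,
coassociativity, or Δ(u) = u ⊗ u; in degree 0 the coface of index 1 inserts σ, and Δσ = σ ⊗ σ takes
the place of coassociativity. Writing `j + 1` for the larger index avoids subtraction. -/
lemma coface_comp_coface (hσ : σ ≫ Δ[H] = (λ_ (𝟙_ B)).inv ≫ (σ ⊗ₘ σ)) (n i j : ℕ)
    (hij : i ≤ j) (hj : j ≤ n + 1) :
    coface H σ n i ≫ coface H σ (n + 1) (j + 1) = coface H σ n j ≫ coface H σ (n + 1) i := by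
  induction n generalizing i j with
  | zero =>
    match i, j with
    | 0, 0 => exact unit_insertion_comul H _
    | 0, j + 1 => exact coface_zero_naturality H σ _
    | 1, 1 => exact grouplike_insertion_comul H hσ
    | i + 2, j => omega
    | 1, j + 2 => omega
  | succ n ih =>
    match i, j with
    | 0, 0 => exact unit_insertion_comul H _
    | 0, j + 1 => exact coface_zero_naturality H σ _
    | 1, 1 => exact comul_insertion_comul H _
    | 1, j + 2 => exact comul_insertion_naturality H _
    | i + 2, j + 2 =>
      exact whiskerLeft_comp_eq_comp H (ih (i + 1) (j + 1) (by omega) (by omega))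

lemma codegeneracy_comp_codegeneracy (n i j : ℕ) (hij : i ≤ j) (hj : j ≤ n) :
    codegeneracy H (n + 1) i ≫ codegeneracy H n j =
      codegeneracy H (n + 1) (j + 1) ≫ codegeneracy H n i := by
  induction n generalizing i j with
  | zero =>
    obtain rfl : j = 0 := by omega
    obtain rfl : i = 0 := by omega
    exact (codegeneracy_zero_naturality H _).symm
  | succ n ih =>
    match i, j with
    | 0, j => exact (codegeneracy_zero_naturality H _).symm
    | i + 1, j + 1 => exact whiskerLeft_comp_eq_comp H (ih i j (by omega) (by omega))

variable (σ) in
lemma coface_comp_codegeneracy_of_le (n i j : ℕ) (hij : i ≤ j) (hj : j ≤ n) :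
    coface H σ (n + 1) i ≫ codegeneracy H (n + 1) (j + 1) =
      codegeneracy H n j ≫ coface H σ n i := by
  induction n generalizing i j with
  | zero =>
    obtain rfl : j = 0 := by omega
    obtain rfl : i = 0 := by omega
    exact coface_zero_naturality H σ _
  | succ n ih =>
    match i, j with
    | 0, j => exact coface_zero_naturality H σ _
    | 1, j + 1 => exact comul_insertion_naturality H _
    | i + 2, j + 1 => exact whiskerLeft_comp_eq_comp H (ih (i + 1) j (by omega) (by omega))

variable (σ) in
lemma coface_comp_codegeneracy_self (n j : ℕ) (hj : j ≤ n) :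
    coface H σ n j ≫ codegeneracy H n j = 𝟙 _ := by
  induction n generalizing j with
  | zero =>
    obtain rfl : j = 0 := by omega
    exact unit_insertion_counit H _
  | succ n ih =>
    -- `codegeneracy H n 0` reduces only once `n` is a constructor, hence two identical cases at
    -- index 1.
    match n, j with
    | n, 0 => exact unit_insertion_counit H _
    | 0, 1 => exact comul_insertion_whiskerLeft_counit H _
    | n + 1, 1 => exact comul_insertion_whiskerLeft_counit H _
    | n + 1, j + 2 => exact whiskerLeft_comp_eq_id H (ih (j + 1) (by omega))

lemma coface_comp_codegeneracy_succ (hσ : σ ≫ ε[H] = 𝟙 (𝟙_ B)) (n j : ℕ) (hj : j ≤ n) :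
    coface H σ n (j + 1) ≫ codegeneracy H n j = 𝟙 _ := by
  induction n generalizing j with
  | zero =>
    obtain rfl : j = 0 := by omega
    exact grouplike_insertion_counit H hσ
  | succ n ih =>
    match j with
    | 0 => exact comul_insertion_counit H _
    | j + 1 => exact whiskerLeft_comp_eq_id H (ih j (by omega))

variable (σ) in
lemma coface_comp_codegeneracy_of_gt (n i j : ℕ) (hij : j ≤ i) (hi : i ≤ n) :
    coface H σ (n + 1) (i + 2) ≫ codegeneracy H (n + 1) j =
      codegeneracy H n j ≫ coface H σ n (i + 1) := by
  induction n generalizing i j with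
  | zero =>
    obtain rfl : j = 0 := by omega
    exact codegeneracy_zero_naturality H _
  | succ n ih =>
    match i, j with
    | i, 0 => exact codegeneracy_zero_naturality H _
    | i + 1, j + 1 => exact whiskerLeft_comp_eq_comp H (ih i j (by omega) (by omega))

end Cosimplicial

end ConnesMoscovici

namespace ConnesMoscovici

variable {B : Type u} [Category.{v} B] [MonoidalCategory B]

/-! ### Translations by characters and multiplications by grouplike elements -/

section Translation

variable {H : B} [ComonObj H]

/-- The morphism `h ↦ φ(h₁) h₂`. -/
def leftTranslation (φ : H ⟶ 𝟙_ B) : H ⟶ H := Δ[H] ≫ φ ▷ H ≫ (λ_ H).hom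

/-- The morphism `h ↦ h₁ φ(h₂)`. -/
def rightTranslation (φ : H ⟶ 𝟙_ B) : H ⟶ H := Δ[H] ≫ H ◁ φ ≫ (ρ_ H).hom

/-- The convolution product `h ↦ φ(h₁) ψ(h₂)`. -/
def functionalConv (φ ψ : H ⟶ 𝟙_ B) : H ⟶ 𝟙_ B := Δ[H] ≫ (φ ⊗ₘ ψ) ≫ (λ_ (𝟙_ B)).hom

/-- By coassociativity both sides are h ↦ φ(h₁) h₂ ψ(h₃). -/
lemma leftTranslation_comp_rightTranslation (φ ψ : H ⟶ 𝟙_ B) :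
    leftTranslation φ ≫ rightTranslation ψ = rightTranslation ψ ≫ leftTranslation φ := by
  calc _ = (Δ[H] ≫ H ◁ Δ[H]) ≫ φ ▷ (H ⊗ H) ≫ (λ_ (H ⊗ H)).hom ≫ H ◁ ψ ≫ (ρ_ H).hom := by
        simp only [leftTranslation, rightTranslation, Category.assoc, leftUnitor_naturality_assoc,
          whisker_exchange_assoc]
    _ = Δ[H] ≫ Δ[H] ▷ H ⊗≫ (φ ▷ (H ⊗ H) ≫ 𝟙_ B ◁ H ◁ ψ) ⊗≫ 𝟙 _ := by
        rw [ComonObj.comul_assoc]; monoidal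
    _ = Δ[H] ≫ (Δ[H] ▷ H ≫ (H ⊗ H) ◁ ψ) ⊗≫ φ ▷ H ⊗≫ 𝟙 _ := by
        rw [← whisker_exchange]; monoidal
    _ = _ := by
        rw [← whisker_exchange, leftTranslation, rightTranslation]; monoidal

lemma leftTranslation_comp_leftTranslation (φ ψ : H ⟶ 𝟙_ B) :
    leftTranslation φ ≫ leftTranslation ψ = leftTranslation (functionalConv φ ψ) := by
  calc _ = (Δ[H] ≫ H ◁ Δ[H]) ≫ φ ▷ (H ⊗ H) ≫ 𝟙_ B ◁ ψ ▷ H ⊗≫ 𝟙 _ := by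
        simp only [leftTranslation, Category.assoc, whisker_exchange_assoc]
        monoidal
    _ = _ := by
        rw [ComonObj.comul_assoc, leftTranslation, functionalConv, MonoidalCategory.tensorHom_def]
        monoidal

lemma rightTranslation_comp_rightTranslation (φ ψ : H ⟶ 𝟙_ B) :
    rightTranslation φ ≫ rightTranslation ψ = rightTranslation (functionalConv ψ φ) := by
  calc _ = Δ[H] ≫ (H ◁ φ ≫ Δ[H] ▷ 𝟙_ B) ⊗≫ H ◁ ψ ⊗≫ 𝟙 _ := by
        rw [rightTranslation, rightTranslation]
        monoidal
    _ = Δ[H] ≫ Δ[H] ▷ H ≫ ((H ⊗ H) ◁ φ ≫ (H ◁ ψ) ▷ 𝟙_ B) ⊗≫ 𝟙 _ := by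
        rw [whisker_exchange]; monoidal
    _ = (Δ[H] ≫ Δ[H] ▷ H ≫ (α_ H H H).hom) ⊗≫ H ◁ (ψ ▷ H ≫ 𝟙_ B ◁ φ) ⊗≫ 𝟙 _ := by
        rw [whisker_exchange]; monoidal
    _ = _ := by
        rw [← ComonObj.comul_assoc, rightTranslation, functionalConv,
          MonoidalCategory.tensorHom_def]
        monoidal

lemma leftTranslation_counit : leftTranslation ε[H] = 𝟙 H := by
  simp [leftTranslation]

lemma rightTranslation_counit : rightTranslation ε[H] = 𝟙 H := by
  simp [rightTranslation]

end Translation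

/-! ### Tensor products of actions -/

section Actions

variable [BraidedCategory B]

section Skip

variable {H : B} [MonObj H] (M : B) {V : B} (b : H ⊗ V ⟶ V)

/-- The action of `H` on the second factor of `M ⊗ V`. -/
def skipAction : H ⊗ M ⊗ V ⟶ M ⊗ V :=
  (α_ H M V).inv ≫ (β_ H M).hom ▷ V ≫ (α_ M H V).hom ≫ M ◁ b

variable {b}

lemma one_skipAction (hb : η[H] ▷ V ≫ b = (λ_ V).hom) :
    η[H] ▷ (M ⊗ V) ≫ skipAction M b = (λ_ (M ⊗ V)).hom := by
  calc _ = 𝟙 _ ⊗≫ (η[H] ▷ M ≫ (β_ H M).hom) ▷ V ⊗≫ M ◁ b := by rw [skipAction]; monoidal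
    _ = 𝟙 _ ⊗≫ (β_ (𝟙_ B) M).hom ▷ V ⊗≫ M ◁ (η[H] ▷ V ≫ b) := by
        rw [BraidedCategory.braiding_naturality_left]; monoidal
    _ = _ := by rw [hb, braiding_tensorUnit_left]; monoidal

lemma mul_skipAction (hb : μ[H] ▷ V ≫ b = (α_ H H V).hom ≫ H ◁ b ≫ b) :
    μ[H] ▷ (M ⊗ V) ≫ skipAction M b =
      (α_ H H (M ⊗ V)).hom ≫ H ◁ skipAction M b ≫ skipAction M b := by
  calc _ = 𝟙 _ ⊗≫ (μ[H] ▷ M ≫ (β_ H M).hom) ▷ V ⊗≫ M ◁ b := by rw [skipAction]; monoidal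
    _ = 𝟙 _ ⊗≫ (β_ (H ⊗ H) M).hom ▷ V ⊗≫ M ◁ (μ[H] ▷ V ≫ b) := by
        rw [BraidedCategory.braiding_naturality_left]; monoidal
    _ = 𝟙 _ ⊗≫ H ◁ (β_ H M).hom ▷ V ⊗≫
          ((β_ H M).hom ▷ (H ⊗ V) ≫ (M ⊗ H) ◁ b) ⊗≫ M ◁ b := by
        rw [hb, BraidedCategory.braiding_tensor_left_hom]; monoidal
    _ = _ := by rw [← whisker_exchange, skipAction]; monoidal

end Skip

/-- The diagonal action of `H` on `M ⊗ V`. -/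
def tensorAction {H : B} [ComonObj H] {M V : B} (a : H ⊗ M ⟶ M) (b : H ⊗ V ⟶ V) :
    H ⊗ M ⊗ V ⟶ M ⊗ V :=
  Δ[H] ▷ (M ⊗ V) ≫ tensorμ H H M V ≫ (a ⊗ₘ b)

section Comon

variable {H : B} [ComonObj H] {M V W M' V' : B} {a : H ⊗ M ⟶ M} {b : H ⊗ V ⟶ V}
  {c : H ⊗ W ⟶ W} {a' : H ⊗ M' ⟶ M'} {b' : H ⊗ V' ⟶ V'}

variable (a b) in
-- In h₁m ⊗ h₂v, the factor h₂ can act first and h₁ afterwards; the braiding then occurs only in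
-- `skipAction`.
lemma tensorAction_eq : tensorAction a b =
    Δ[H] ▷ (M ⊗ V) ≫ (α_ H H (M ⊗ V)).hom ≫ H ◁ skipAction M b ≫ (α_ H M V).inv ≫ a ▷ V := by
  rw [tensorAction, tensorμ, skipAction, MonoidalCategory.tensorHom_def']
  monoidal

lemma tensorAction_naturality {f : M ⟶ M'} {g : V ⟶ V'} (hf : H ◁ f ≫ a' = a ≫ f)
    (hg : H ◁ g ≫ b' = b ≫ g) :
    H ◁ (f ⊗ₘ g) ≫ tensorAction a' b' = tensorAction a b ≫ (f ⊗ₘ g) := by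
  rw [tensorAction, whisker_exchange_assoc, tensorμ_natural_right_assoc,
    tensorHom_comp_tensorHom, hf, hg, ← tensorHom_comp_tensorHom, tensorAction, Category.assoc,
    Category.assoc]

/-- Coassociativity of Δ combined with the associativity coherence of `tensorμ`. -/
lemma tensorAction_associator (a : H ⊗ M ⟶ M) (b : H ⊗ V ⟶ V) (c : H ⊗ W ⟶ W) :
    H ◁ (α_ M V W).hom ≫ tensorAction a (tensorAction b c) =
      tensorAction (tensorAction a b) c ≫ (α_ M V W).hom := by
  calc _ = ((Δ[H] ≫ H ◁ Δ[H]) ⊗ₘ (α_ M V W).hom) ≫ tensorμ H (H ⊗ H) M (V ⊗ W) ≫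
          (H ⊗ M) ◁ tensorμ H H V W ≫ (a ⊗ₘ b ⊗ₘ c) := by
        have h : tensorμ H H M (V ⊗ W) ≫ (a ⊗ₘ tensorAction b c) =
            (H ◁ Δ[H]) ▷ (M ⊗ V ⊗ W) ≫ tensorμ H (H ⊗ H) M (V ⊗ W) ≫
              (H ⊗ M) ◁ tensorμ H H V W ≫ (a ⊗ₘ b ⊗ₘ c) := by
          rw [← id_tensorHom, tensorμ_natural_left_assoc, ← id_tensorHom,
            tensorHom_comp_tensorHom, tensorHom_comp_tensorHom, tensorAction]
          simp
        rw [tensorAction, h, MonoidalCategory.tensorHom_def' (Δ[H] ≫ H ◁ Δ[H])]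
        simp only [comp_whiskerRight, Category.assoc]
    _ = Δ[H] ▷ ((M ⊗ V) ⊗ W) ≫ Δ[H] ▷ H ▷ ((M ⊗ V) ⊗ W) ≫
          ((α_ H H H).hom ⊗ₘ (α_ M V W).hom) ≫ tensorμ H (H ⊗ H) M (V ⊗ W) ≫
          (H ⊗ M) ◁ tensorμ H H V W ≫ (a ⊗ₘ b ⊗ₘ c) := by
        rw [ComonObj.comul_assoc]; monoidal
    _ = Δ[H] ▷ ((M ⊗ V) ⊗ W) ≫ Δ[H] ▷ H ▷ ((M ⊗ V) ⊗ W) ≫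
          tensorμ (H ⊗ H) H (M ⊗ V) W ≫ tensorμ H H M V ▷ (H ⊗ W) ≫
          ((a ⊗ₘ b) ⊗ₘ c) ≫ (α_ M V W).hom := by
        rw [← associator_monoidal_assoc, ← MonoidalCategory.associator_naturality]
    _ = _ := by
        have h : tensorμ H H (M ⊗ V) W ≫ (tensorAction a b ⊗ₘ c) =
            (Δ[H] ▷ H) ▷ ((M ⊗ V) ⊗ W) ≫ tensorμ (H ⊗ H) H (M ⊗ V) W ≫
              tensorμ H H M V ▷ (H ⊗ W) ≫ ((a ⊗ₘ b) ⊗ₘ c) := by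
          rw [← tensorHom_id Δ[H] H, tensorμ_natural_left_assoc,
            ← tensorHom_id (tensorμ H H M V),
            tensorHom_comp_tensorHom, tensorHom_comp_tensorHom, tensorAction]
          simp
        rw [tensorAction, Category.assoc, Category.assoc, reassoc_of% h]

lemma tensorAction_leftUnitor (b : H ⊗ V ⟶ V) :
    H ◁ (λ_ V).hom ≫ b = tensorAction (ε[H] ▷ 𝟙_ B ≫ (λ_ (𝟙_ B)).hom) b ≫ (λ_ V).hom := by
  symm
  calc _ = (Δ[H] ≫ ε[H] ▷ H) ▷ (𝟙_ B ⊗ V) ≫ tensorμ (𝟙_ B) H (𝟙_ B) V ≫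
          (λ_ (𝟙_ B)).hom ▷ (H ⊗ V) ≫ (λ_ (H ⊗ V)).hom ≫ b := by
        rw [comp_whiskerRight, Category.assoc, ← tensorHom_id ε[H] H, tensorμ_natural_left_assoc,
          tensorAction]
        simp only [MonoidalCategory.tensorHom_def, comp_whiskerRight, id_whiskerRight,
          whiskerLeft_id, Category.id_comp, Category.assoc, leftUnitor_naturality]
    _ = _ := by
        rw [← leftUnitor_monoidal_assoc, ComonObj.counit_comul,
          MonoidalCategory.tensorHom_def_assoc]
        monoidal

lemma tensorAction_rightUnitor (b : H ⊗ V ⟶ V) :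
    H ◁ (ρ_ V).hom ≫ b = tensorAction b (ε[H] ▷ 𝟙_ B ≫ (λ_ (𝟙_ B)).hom) ≫ (ρ_ V).hom := by
  symm
  calc _ = (Δ[H] ≫ H ◁ ε[H]) ▷ (V ⊗ 𝟙_ B) ≫ tensorμ H (𝟙_ B) V (𝟙_ B) ≫
          (H ⊗ V) ◁ (λ_ (𝟙_ B)).hom ≫ (ρ_ (H ⊗ V)).hom ≫ b := by
        rw [comp_whiskerRight, Category.assoc, ← id_tensorHom H ε[H], tensorμ_natural_left_assoc,
          tensorAction, Category.assoc, Category.assoc, id_whiskerRight,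
          ← rightUnitor_naturality, MonoidalCategory.tensorHom_def',
          MonoidalCategory.tensorHom_def']
        simp
    _ = _ := by
        rw [← rightUnitor_monoidal_assoc, ComonObj.comul_counit,
          MonoidalCategory.tensorHom_def_assoc]
        monoidal

end Comon

section Bimon

variable {H : B} [BimonObj H] {M V : B} {a : H ⊗ M ⟶ M} {b : H ⊗ V ⟶ V}

lemma one_tensorAction (ha : η[H] ▷ M ≫ a = (λ_ M).hom) (hb : η[H] ▷ V ≫ b = (λ_ V).hom) :
    η[H] ▷ (M ⊗ V) ≫ tensorAction a b = (λ_ (M ⊗ V)).hom := by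
  rw [tensorAction, ← comp_whiskerRight_assoc, Bimon.one_comul, comp_whiskerRight,
    Category.assoc, tensorμ_natural_left_assoc, tensorHom_comp_tensorHom, ha, hb,
    tensor_left_unitality]

/-- The bialgebra axiom splits Δ(hg), and the coherence of `tensorμ` regroups the four factors into
two successive actions. -/
lemma mul_tensorAction (ha : μ[H] ▷ M ≫ a = (α_ H H M).hom ≫ H ◁ a ≫ a)
    (hb : μ[H] ▷ V ≫ b = (α_ H H V).hom ≫ H ◁ b ≫ b) :
    μ[H] ▷ (M ⊗ V) ≫ tensorAction a b =
      (α_ H H (M ⊗ V)).hom ≫ H ◁ tensorAction a b ≫ tensorAction a b := by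
  calc _ = (Δ[H] ⊗ₘ Δ[H]) ▷ (M ⊗ V) ≫ tensorμ H H H H ▷ (M ⊗ V) ≫
          tensorμ (H ⊗ H) (H ⊗ H) M V ≫ (μ[H] ▷ M ≫ a ⊗ₘ μ[H] ▷ V ≫ b) := by
        rw [tensorAction, ← comp_whiskerRight_assoc, BimonObj.mul_comul, comp_whiskerRight,
          comp_whiskerRight, Category.assoc, Category.assoc, tensorμ_natural_left_assoc,
          tensorHom_comp_tensorHom]
    _ = (Δ[H] ⊗ₘ Δ[H]) ▷ (M ⊗ V) ≫ (α_ (H ⊗ H) (H ⊗ H) (M ⊗ V)).hom ≫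
          (H ⊗ H) ◁ tensorμ H H M V ≫ (H ⊗ H) ◁ (a ⊗ₘ b) ≫ tensorμ H H M V ≫ (a ⊗ₘ b) := by
        rw [ha, hb, ← tensorHom_comp_tensorHom, tensor_associativity_assoc,
          ← tensorHom_comp_tensorHom, tensorμ_natural_right_assoc]
    _ = _ := by
        have h : (Δ[H] ⊗ₘ Δ[H]) ▷ (M ⊗ V) ≫ (α_ (H ⊗ H) (H ⊗ H) (M ⊗ V)).hom =
            (α_ H H (M ⊗ V)).hom ≫ H ◁ Δ[H] ▷ (M ⊗ V) ≫ Δ[H] ▷ ((H ⊗ H) ⊗ M ⊗ V) := by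
          rw [← MonoidalCategory.tensorHom_def', ← tensorHom_id, associator_naturality,
            tensorHom_id]
        rw [reassoc_of% h, ← whisker_exchange_assoc, ← whisker_exchange_assoc, tensorAction]
        simp only [whiskerLeft_comp, Category.assoc]

/-- The bialgebra axiom, read as H-linearity of Δ for left multiplication and the diagonal action.
-/
lemma comul_equivariant : H ◁ Δ[H] ≫ tensorAction μ[H] μ[H] = μ[H] ≫ Δ[H] := by
  rw [BimonObj.mul_comul, tensorAction, MonoidalCategory.tensorHom_def' Δ[H], Category.assoc]

lemma counit_equivariant :
    H ◁ ε[H] ≫ ε[H] ▷ 𝟙_ B ≫ (λ_ (𝟙_ B)).hom = μ[H] ≫ ε[H] := by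
  rw [Bimon.mul_counit, MonoidalCategory.tensorHom_def', Category.assoc]

end Bimon

end Actions

end ConnesMoscovici

/-! ### The twisted antipode and its square -/

namespace ConnesMoscovici

variable {B : Type u} [Category.{v} B] [MonoidalCategory B] [BraidedCategory B]

section TwistedAntipode

variable {H : B} [HopfObj H] {δ : H ⟶ 𝟙_ B} {σ : 𝟙_ B ⟶ H}

lemma twistedAntipode_eq : twistedAntipode H δ = leftTranslation δ ≫ 𝒮[H] := by
  simp [twistedAntipode, leftTranslation]

lemma coconjugation_eq :
    coconjugation H δ = leftTranslation (𝒮[H] ≫ δ) ≫ rightTranslation δ := by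
  simp [coconjugation, leftTranslation, rightTranslation]

/-- Both Δ and δ ⊗ id are multiplicative, the latter by naturality of `tensorμ`. -/
lemma mul_leftTranslation (hδ : μ[H] ≫ δ = (δ ⊗ₘ δ) ≫ (λ_ (𝟙_ B)).hom) :
    μ[H] ≫ leftTranslation δ = (leftTranslation δ ⊗ₘ leftTranslation δ) ≫ μ[H] := by
  calc _ = (Δ[H] ⊗ₘ Δ[H]) ≫ tensorμ H H H H ≫ ((δ ⊗ₘ δ) ⊗ₘ (𝟙 H ⊗ₘ 𝟙 H)) ≫
          (λ_ (𝟙_ B)).hom ▷ (H ⊗ H) ≫ (λ_ (H ⊗ H)).hom ≫ μ[H] := by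
        rw [leftTranslation, BimonObj.mul_comul_assoc, ← tensorHom_id,
          tensorHom_comp_tensorHom_assoc, hδ, ← leftUnitor_naturality]
        simp only [MonoidalCategory.tensorHom_def _ μ[H], tensorHom_id, id_whiskerRight,
          comp_whiskerRight, Category.assoc, Category.comp_id]
    _ = _ := by
        rw [← tensorμ_natural_assoc, ← leftUnitor_monoidal_assoc, leftTranslation]
        simp only [tensorHom_comp_tensorHom_assoc, tensorHom_id]

lemma one_leftTranslation (hδ : η[H] ≫ δ = 𝟙 (𝟙_ B)) : η[H] ≫ leftTranslation δ = η[H] := by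
  rw [leftTranslation, Bimon.one_comul_assoc, ← tensorHom_id, tensorHom_comp_tensorHom_assoc, hδ]
  simp

lemma mul_twistedAntipode (hδ : μ[H] ≫ δ = (δ ⊗ₘ δ) ≫ (λ_ (𝟙_ B)).hom) :
    μ[H] ≫ twistedAntipode H δ =
      (β_ H H).hom ≫ (twistedAntipode H δ ⊗ₘ twistedAntipode H δ) ≫ μ[H] := by
  rw [twistedAntipode_eq, reassoc_of% mul_leftTranslation hδ, HopfObj.mul_antipode,
    tensorHom_comp_tensorHom_assoc, BraidedCategory.braiding_naturality_assoc]

lemma one_twistedAntipode (hδ : η[H] ≫ δ = 𝟙 (𝟙_ B)) :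
    η[H] ≫ twistedAntipode H δ = η[H] := by
  rw [twistedAntipode_eq, reassoc_of% one_leftTranslation hδ, HopfObj.one_antipode]

/-- δ(h₁)S(h₂)h₃ = δ(h₁)ε(h₂)1. -/
lemma twistedAntipode_convolution :
    Δ[H] ≫ twistedAntipode H δ ▷ H ≫ μ[H] = δ ≫ η[H] := by
  calc _ = (Δ[H] ≫ Δ[H] ▷ H ≫ (α_ H H H).hom) ≫ δ ▷ (H ⊗ H) ≫ (λ_ (H ⊗ H)).hom ≫
          𝒮[H] ▷ H ≫ μ[H] := by
        rw [twistedAntipode]; monoidal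
    _ = Δ[H] ≫ δ ▷ H ≫ (λ_ H).hom ≫ Δ[H] ≫ 𝒮[H] ▷ H ≫ μ[H] := by
        rw [← ComonObj.comul_assoc, Category.assoc, whisker_exchange_assoc,
          leftUnitor_naturality_assoc]
    _ = (Δ[H] ≫ H ◁ ε[H]) ≫ δ ▷ 𝟙_ B ≫ (λ_ (𝟙_ B)).hom ≫ η[H] := by
        rw [HopfObj.antipode_left, Category.assoc, whisker_exchange_assoc,
          leftUnitor_naturality_assoc]
    _ = _ := by rw [ComonObj.comul_counit]; monoidal

/-- δ(h₁)δ(S(h₂)) = δ(h₁S(h₂)) = ε(h). -/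
lemma functionalConv_antipode (hδ : IsModularPair H δ σ) :
    functionalConv δ (𝒮[H] ≫ δ) = ε[H] := by
  have : δ ⊗ₘ (𝒮[H] ≫ δ) = H ◁ 𝒮[H] ≫ (δ ⊗ₘ δ) := by
    rw [← id_tensorHom, tensorHom_comp_tensorHom, Category.id_comp]
  rw [functionalConv, this, Category.assoc, ← hδ.mul_character, HopfObj.antipode_right_assoc,
    hδ.one_character, Category.comp_id]

lemma twistedAntipode_character (hδ : IsModularPair H δ σ) :
    twistedAntipode H δ ≫ δ = ε[H] := by
  rw [← functionalConv_antipode hδ, functionalConv, twistedAntipode,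
    MonoidalCategory.tensorHom_def]
  simp

lemma grouplike_twistedAntipode (hδ : IsModularPair H δ σ) :
    σ ≫ twistedAntipode H δ = σ ≫ 𝒮[H] := by
  rw [twistedAntipode, reassoc_of% hδ.grouplike_comul, ← tensorHom_id,
    tensorHom_comp_tensorHom_assoc, hδ.grouplike_character]
  simp

lemma grouplike_antipode_mul (hδ : IsModularPair H δ σ) :
    (λ_ (𝟙_ B)).inv ≫ ((σ ≫ 𝒮[H]) ⊗ₘ σ) ≫ μ[H] = η[H] := by
  have : (σ ≫ 𝒮[H]) ⊗ₘ σ = (σ ⊗ₘ σ) ≫ 𝒮[H] ▷ H := by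
    rw [← tensorHom_id, tensorHom_comp_tensorHom, Category.comp_id]
  rw [this, Category.assoc, ← reassoc_of% hδ.grouplike_comul, HopfObj.antipode_left,
    reassoc_of% hδ.grouplike_counit]

/-- The morphism `h ↦ σ h`. -/
def leftMul (σ : 𝟙_ B ⟶ H) : H ⟶ H := (λ_ H).inv ≫ σ ▷ H ≫ μ[H]

/-- The morphism `h ↦ h σ`. -/
def rightMul (σ : 𝟙_ B ⟶ H) : H ⟶ H := (ρ_ H).inv ≫ H ◁ σ ≫ μ[H]

/-- S(σ) is a left inverse of σ, since S(σ)σ = ε(σ)1 for grouplike σ. -/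
lemma conjugation_comp_rightMul (hδ : IsModularPair H δ σ) :
    conjugation H σ ≫ rightMul σ = leftMul σ := by
  have h : rightMul (σ ≫ 𝒮[H]) ≫ rightMul σ = 𝟙 H := by
    calc _ = (ρ_ H).inv ≫ (H ◁ (σ ≫ 𝒮[H]) ≫ μ[H] ≫ (ρ_ H).inv) ≫ H ◁ σ ≫ μ[H] := by
          simp [rightMul]
      _ = 𝟙 H ⊗≫ (H ◁ (σ ≫ 𝒮[H])) ▷ 𝟙_ B ≫ (H ⊗ H) ◁ σ ≫ μ[H] ▷ H ≫ μ[H] := by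
          rw [whisker_exchange_assoc]; monoidal
      _ = (ρ_ H).inv ≫ H ◁ ((λ_ (𝟙_ B)).inv ≫ ((σ ≫ 𝒮[H]) ⊗ₘ σ) ≫ μ[H]) ≫ μ[H] := by
          rw [MonObj.mul_assoc, MonoidalCategory.tensorHom_def]; monoidal
      _ = _ := by rw [grouplike_antipode_mul hδ, MonObj.mul_one, Iso.inv_hom_id]
  have h' : conjugation H σ = leftMul σ ≫ rightMul (σ ≫ 𝒮[H]) := by
    simp [conjugation, leftMul, rightMul]
  rw [h', Category.assoc, h, Category.comp_id]

/-- The antipode reverses the comultiplication, so a left translation becomes a right one. The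
braiding that appears disappears against the unit object once φ is applied. -/
lemma antipode_leftTranslation (φ : H ⟶ 𝟙_ B) :
    𝒮[H] ≫ leftTranslation φ = rightTranslation (𝒮[H] ≫ φ) ≫ 𝒮[H] := by
  have : (𝒮[H] ⊗ₘ 𝒮[H]) ≫ φ ▷ H = (𝒮[H] ≫ φ) ▷ H ≫ 𝟙_ B ◁ 𝒮[H] := by
    rw [MonoidalCategory.tensorHom_def, Category.assoc, whisker_exchange, comp_whiskerRight,
      Category.assoc]
  rw [leftTranslation, reassoc_of% HopfObj.antipode_comul H, reassoc_of% this,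
    leftUnitor_naturality, ← BraidedCategory.braiding_naturality_right_assoc,
    braiding_leftUnitor_assoc, rightTranslation]
  simp

/-- The only place where the involution condition is unpacked. Moving S past the second left
translation produces S² surrounded by translations by δ and δS; these cancel in pairs by
`functionalConv_antipode`, and right multiplication by σ cancels S(σ). -/
lemma twistedAntipode_sq {θ : BraidedTwist B} (h : IsTwistedModularPairInInvolution θ H δ σ) :
    twistedAntipode H δ ≫ twistedAntipode H δ ≫ rightMul σ = θ.app H ≫ leftMul σ := by
  have hδ := h.toIsModularPair
  calc _ = leftTranslation δ ≫ rightTranslation (𝒮[H] ≫ δ) ≫ (𝒮[H] ≫ 𝒮[H]) ≫ rightMul σ := by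
        rw [twistedAntipode_eq]
        simp only [Category.assoc]
        rw [reassoc_of% antipode_leftTranslation]
    _ = (leftTranslation δ ≫ leftTranslation (𝒮[H] ≫ δ)) ≫
          (rightTranslation (𝒮[H] ≫ δ) ≫ rightTranslation δ) ≫
          θ.app H ≫ conjugation H σ ≫ rightMul σ := by
        rw [h.antipode_sq, coconjugation_eq]
        simp only [Category.assoc]
        rw [← reassoc_of% leftTranslation_comp_rightTranslation]
    _ = _ := by
        rw [leftTranslation_comp_leftTranslation, rightTranslation_comp_rightTranslation,
          functionalConv_antipode hδ, leftTranslation_counit, rightTranslation_counit,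
          Category.id_comp, Category.id_comp, conjugation_comp_rightMul hδ]

end TwistedAntipode

/-! ### Semi-invariance and the untwisting of diagonal actions -/

section Coinvariants

variable {H : B} [HopfObj H] {M V : B} {a : H ⊗ M ⟶ M} {b : H ⊗ V ⟶ V}

/-- If `s` is an antimultiplicative left convolution inverse of the identity twisted by `φ`,
then `h ⊗ v ↦ s(h) v` is `φ`-semi-invariant for the diagonal action. -/
lemma tensorAction_comp_antiaction {s : H ⟶ H} {φ : H ⟶ 𝟙_ B}
    (hs : μ[H] ≫ s = (β_ H H).hom ≫ (s ⊗ₘ s) ≫ μ[H]) (hφ : Δ[H] ≫ s ▷ H ≫ μ[H] = φ ≫ η[H])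
    (hb : η[H] ▷ V ≫ b = (λ_ V).hom) (hb' : μ[H] ▷ V ≫ b = (α_ H H V).hom ≫ H ◁ b ≫ b) :
    tensorAction μ[H] b ≫ s ▷ V ≫ b = φ ▷ (H ⊗ V) ≫ (λ_ (H ⊗ V)).hom ≫ s ▷ V ≫ b := by
  have h : s ▷ (H ⊗ V) ≫ H ◁ b ≫ b = (α_ H H V).inv ≫ (s ▷ H ≫ μ[H]) ▷ V ≫ b := by
    rw [comp_whiskerRight, Category.assoc, hb']; simp
  calc _ = 𝟙 _ ⊗≫ Δ[H] ▷ H ▷ V ⊗≫ H ◁ (β_ H H).hom ▷ V ⊗≫ (μ[H] ≫ s) ▷ (H ⊗ V) ≫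
          H ◁ b ≫ b := by
        rw [tensorAction, tensorμ, MonoidalCategory.tensorHom_def']
        simp only [Category.assoc]
        rw [← comp_whiskerRight_assoc, whisker_exchange_assoc]
        monoidal
    _ = 𝟙 _ ⊗≫ (Δ[H] ▷ H ≫ (β_ (H ⊗ H) H).hom) ▷ V ⊗≫
          (s ⊗ₘ s) ▷ (H ⊗ V) ≫ (μ[H] ▷ (H ⊗ V) ≫ H ◁ b) ≫ b := by
        rw [hs, BraidedCategory.braiding_tensor_left_hom]
        monoidal
    -- Sliding Δ through the braiding puts s(h₁) next to h₂, ready for `hφ`: s(h₁g)h₂v =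
    -- s(g)s(h₁)h₂v, up to braiding.
    _ = 𝟙 _ ⊗≫ ((β_ H H).hom ≫ H ◁ Δ[H]) ▷ V ⊗≫
          (s ⊗ₘ s) ▷ (H ⊗ V) ⊗≫ H ◁ H ◁ b ≫ H ◁ b ≫ b := by
        rw [BraidedCategory.braiding_naturality_left, ← whisker_exchange, Category.assoc, hb']
        monoidal
    _ = 𝟙 _ ⊗≫ ((β_ H H).hom ≫ H ◁ Δ[H]) ▷ V ⊗≫
          H ◁ (s ▷ (H ⊗ V) ≫ H ◁ b ≫ b) ≫ s ▷ V ≫ b := by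
        simp only [whiskerLeft_comp, Category.assoc, whisker_exchange_assoc,
          MonoidalCategory.tensorHom_def]
        monoidal
    _ = 𝟙 _ ⊗≫ (β_ H H).hom ▷ V ⊗≫ H ◁ ((Δ[H] ≫ s ▷ H ≫ μ[H]) ▷ V ≫ b) ≫ s ▷ V ≫ b := by
        rw [h]; monoidal
    _ = 𝟙 _ ⊗≫ ((β_ H H).hom ≫ H ◁ φ) ▷ V ⊗≫ H ◁ (η[H] ▷ V ≫ b) ≫ s ▷ V ≫ b := by
        rw [hφ]; monoidal
    _ = _ := by
        rw [← BraidedCategory.braiding_naturality_left, hb, braiding_tensorUnit_left]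
        monoidal

/-- `h · m ⊗ v = h₁ · (m ⊗ S(h₂) v)`. -/
lemma whiskerRight_action_eq (a : H ⊗ M ⟶ M)
    (hb : η[H] ▷ V ≫ b = (λ_ V).hom) (hb' : μ[H] ▷ V ≫ b = (α_ H H V).hom ≫ H ◁ b ≫ b) :
    (α_ H M V).inv ≫ a ▷ V =
      Δ[H] ▷ (M ⊗ V) ≫ (α_ H H (M ⊗ V)).hom ≫
        H ◁ (𝒮[H] ▷ (M ⊗ V) ≫ skipAction M b) ≫ tensorAction a b := by
  -- The two successive actions on V combine into h₂S(h₃), which the antipode axiom then collapses.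
  have h : H ◁ (𝒮[H] ▷ (M ⊗ V)) ≫ H ◁ skipAction M b ≫ skipAction M b =
      (α_ H H (M ⊗ V)).inv ≫ (H ◁ 𝒮[H] ≫ μ[H]) ▷ (M ⊗ V) ≫ skipAction M b := by
    rw [comp_whiskerRight, Category.assoc, mul_skipAction M hb']; simp
  symm
  calc _ = 𝟙 _ ⊗≫ (Δ[H] ≫ Δ[H] ▷ H ≫ (α_ H H H).hom) ▷ (M ⊗ V) ⊗≫
          H ◁ (H ◁ (𝒮[H] ▷ (M ⊗ V)) ≫ H ◁ skipAction M b ≫ skipAction M b) ≫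
          (α_ H M V).inv ≫ a ▷ V := by
        rw [tensorAction_eq, whisker_exchange_assoc]
        monoidal
    _ = 𝟙 _ ⊗≫ (Δ[H] ≫ H ◁ (Δ[H] ≫ H ◁ 𝒮[H] ≫ μ[H])) ▷ (M ⊗ V) ⊗≫
          H ◁ skipAction M b ≫ (α_ H M V).inv ≫ a ▷ V := by
        rw [h, ← ComonObj.comul_assoc]
        monoidal
    _ = 𝟙 _ ⊗≫ (Δ[H] ≫ H ◁ ε[H]) ▷ (M ⊗ V) ⊗≫ H ◁ (η[H] ▷ (M ⊗ V) ≫ skipAction M b) ≫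
          (α_ H M V).inv ≫ a ▷ V := by
        rw [HopfObj.antipode_right]
        monoidal
    _ = _ := by
        rw [one_skipAction M hb, ComonObj.comul_counit]
        monoidal

/-- `s(h₁) · (h₂ ⊗ v) = 1 ⊗ ...` -/
lemma comul_comp_antiaction {s : H ⟶ H} {φ : H ⟶ 𝟙_ B}
    (hφ : Δ[H] ≫ s ▷ H ≫ μ[H] = φ ≫ η[H])
    (hb : η[H] ▷ V ≫ b = (λ_ V).hom) (hb' : μ[H] ▷ V ≫ b = (α_ H H V).hom ≫ H ◁ b ≫ b) :
    (Δ[H] ▷ V ≫ (α_ H H V).hom) ≫ s ▷ (H ⊗ V) ≫ tensorAction μ[H] b =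
      (leftTranslation φ ≫ 𝒮[H]) ▷ V ≫ b ≫ (λ_ V).inv ≫ η[H] ▷ V := by
  have h₁ : H ◁ ((λ_ V).inv ≫ η[H] ▷ V) ≫ skipAction H b = b ≫ (λ_ V).inv ≫ η[H] ▷ V := by
    calc _ = 𝟙 _ ⊗≫ (H ◁ η[H] ≫ (β_ H H).hom) ▷ V ⊗≫ H ◁ b := by rw [skipAction]; monoidal
      _ = 𝟙 _ ⊗≫ (β_ H (𝟙_ B)).hom ▷ V ⊗≫ (η[H] ▷ (H ⊗ V) ≫ H ◁ b) := by
          rw [BraidedCategory.braiding_naturality_right]; monoidal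
      _ = _ := by rw [← whisker_exchange, braiding_tensorUnit_right]; monoidal
  have h₂ : H ◁ ((λ_ V).inv ≫ η[H] ▷ V) ≫ (α_ H H V).inv ≫ μ[H] ▷ V = 𝟙 (H ⊗ V) := by
    calc _ = 𝟙 _ ⊗≫ (H ◁ η[H] ≫ μ[H]) ▷ V := by monoidal
      _ = _ := by rw [MonObj.mul_one]; monoidal
  -- Untwisting: h ⊗ v = h₁·(1 ⊗ S(h₂)v).
  have h₃ : Δ[H] ▷ V ≫ (α_ H H V).hom ≫ H ◁ (𝒮[H] ▷ V ≫ b ≫ (λ_ V).inv ≫ η[H] ▷ V) ≫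
      tensorAction μ[H] b = 𝟙 (H ⊗ V) := by
    rw [← h₂, whiskerRight_action_eq μ[H] hb hb', ← h₁, whisker_exchange_assoc,
      associator_naturality_right_assoc, ← whiskerLeft_comp_assoc, whisker_exchange_assoc]
  have h₄ := mul_tensorAction (H := H) (MonObj.mul_assoc H) hb'
  -- Applying `h₃` to h₂ ⊗ v gives s(h₁)h₂·(1 ⊗ S(h₃)v), where `hφ` replaces s(h₁)h₂ by φ(h₁).
  calc _ = (Δ[H] ▷ V ≫ (α_ H H V).hom) ≫ s ▷ (H ⊗ V) ≫ H ◁ (Δ[H] ▷ V ≫ (α_ H H V).hom ≫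
          H ◁ (𝒮[H] ▷ V ≫ b ≫ (λ_ V).inv ≫ η[H] ▷ V) ≫ tensorAction μ[H] b) ≫
          tensorAction μ[H] b := by
        rw [h₃, whiskerLeft_id, Category.id_comp]
    _ = (Δ[H] ≫ H ◁ Δ[H]) ▷ V ⊗≫ (s ▷ (H ⊗ H ⊗ V) ≫
          H ◁ H ◁ (𝒮[H] ▷ V ≫ b ≫ (λ_ V).inv ≫ η[H] ▷ V)) ≫ (α_ H H (H ⊗ V)).inv ≫
          μ[H] ▷ (H ⊗ V) ≫ tensorAction μ[H] b := by
        rw [h₄]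
        simp only [whiskerLeft_comp, Category.assoc, Iso.inv_hom_id_assoc,
          ← whisker_exchange_assoc]
        monoidal
    _ = (Δ[H] ≫ (Δ[H] ≫ s ▷ H ≫ μ[H]) ▷ H) ▷ V ⊗≫
          H ◁ (𝒮[H] ▷ V ≫ b ≫ (λ_ V).inv ≫ η[H] ▷ V) ≫ tensorAction μ[H] b := by
        rw [ComonObj.comul_assoc, Category.assoc, associator_inv_naturality_right_assoc,
          whisker_exchange_assoc]
        monoidal
    _ = (Δ[H] ≫ φ ▷ H) ▷ V ⊗≫ (η[H] ▷ (H ⊗ V) ≫ H ◁ (𝒮[H] ▷ V ≫ b ≫ (λ_ V).inv ≫ η[H] ▷ V)) ≫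
          tensorAction μ[H] b := by
        rw [hφ]; monoidal
    _ = _ := by
        rw [← whisker_exchange, Category.assoc, one_tensorAction (MonObj.one_mul H) hb,
          leftTranslation]
        monoidal

end Coinvariants

end ConnesMoscovici

/-! ### Appending a last tensor factor -/

namespace ConnesMoscovici

variable {B : Type u} [Category.{v} B] [MonoidalCategory B]

section Snoc

variable (H : B)

/-- The canonical morphism `H^{⊗ n} ⊗ H ⟶ H^{⊗ (n + 1)}`. -/
def snoc : (n : ℕ) → (tensorPow H n ⊗ H ⟶ tensorPow H (n + 1))
  | 0 => (λ_ H).hom ≫ (ρ_ H).inv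
  | n + 1 => (α_ H (tensorPow H n) H).hom ≫ H ◁ snoc n

/-- Separates σ, which is not assumed H-linear, from the map `snoc`, which is. -/
lemma insertLast_eq (σ : 𝟙_ B ⟶ H) (n : ℕ) :
    insertLast H σ n = (ρ_ (tensorPow H n)).inv ≫ tensorPow H n ◁ σ ≫ snoc H n := by
  induction n with
  | zero =>
    change (ρ_ (𝟙_ B)).inv ≫ σ ▷ 𝟙_ B = (ρ_ (𝟙_ B)).inv ≫ 𝟙_ B ◁ σ ≫ (λ_ H).hom ≫ (ρ_ H).inv
    monoidal
  | succ n ih =>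
    have h : ∀ {X Y : B} (f : X ⊗ H ⟶ Y), H ◁ ((ρ_ X).inv ≫ X ◁ σ ≫ f) =
        (ρ_ (H ⊗ X)).inv ≫ (H ⊗ X) ◁ σ ≫ (α_ H X H).hom ≫ H ◁ f := by
      intros; monoidal
    exact (congrArg (H ◁ ·) ih).trans (h _)

end Snoc

variable [BraidedCategory B]

/-! ### Equivariant maps for the diagonal action -/

section Equivariance

variable {H : B} [BimonObj H] {M V W : B}

lemma one_counitAction : η[H] ▷ 𝟙_ B ≫ ε[H] ▷ 𝟙_ B ≫ (λ_ (𝟙_ B)).hom = (λ_ (𝟙_ B)).hom := by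
  rw [← comp_whiskerRight_assoc, BimonObj.one_counit]; simp

lemma mul_counitAction : μ[H] ▷ 𝟙_ B ≫ ε[H] ▷ 𝟙_ B ≫ (λ_ (𝟙_ B)).hom =
    (α_ H H (𝟙_ B)).hom ≫ H ◁ (ε[H] ▷ 𝟙_ B ≫ (λ_ (𝟙_ B)).hom) ≫
      ε[H] ▷ 𝟙_ B ≫ (λ_ (𝟙_ B)).hom := by
  rw [← comp_whiskerRight_assoc, Bimon.mul_counit, MonoidalCategory.tensorHom_def']
  monoidal

lemma whiskerLeft_equivariant {a : H ⊗ M ⟶ M} {b : H ⊗ V ⟶ V} {c : H ⊗ W ⟶ W} {f : V ⟶ W}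
    (hf : H ◁ f ≫ c = b ≫ f) :
    H ◁ (M ◁ f) ≫ tensorAction a c = tensorAction a b ≫ M ◁ f := by
  have := tensorAction_naturality (a := a) (a' := a) (f := 𝟙 M) (by simp) hf
  simpa using this

lemma comul_insertion_equivariant (b : H ⊗ V ⟶ V) :
    H ◁ (Δ[H] ▷ V ≫ (α_ H H V).hom) ≫ tensorAction μ[H] (tensorAction μ[H] b) =
      tensorAction μ[H] b ≫ Δ[H] ▷ V ≫ (α_ H H V).hom := by
  have := tensorAction_naturality (b := b) (b' := b) (g := 𝟙 V)
    (comul_equivariant (H := H)) (by simp)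
  rw [tensorHom_id] at this
  rw [whiskerLeft_comp, Category.assoc, tensorAction_associator, reassoc_of% this]

lemma counit_contraction_equivariant (b : H ⊗ V ⟶ V) :
    H ◁ (ε[H] ▷ V ≫ (λ_ V).hom) ≫ b = tensorAction μ[H] b ≫ ε[H] ▷ V ≫ (λ_ V).hom := by
  have := tensorAction_naturality (b := b) (b' := b) (g := 𝟙 V)
    (counit_equivariant (H := H)) (by simp)
  rw [tensorHom_id] at this
  rw [whiskerLeft_comp, Category.assoc, tensorAction_leftUnitor, reassoc_of% this]

lemma unit_swap_equivariant (b : H ⊗ V ⟶ V) :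
    H ◁ ((λ_ V).hom ≫ (ρ_ V).inv) ≫ tensorAction b (ε[H] ▷ 𝟙_ B ≫ (λ_ (𝟙_ B)).hom) =
      tensorAction (ε[H] ▷ 𝟙_ B ≫ (λ_ (𝟙_ B)).hom) b ≫ (λ_ V).hom ≫ (ρ_ V).inv := by
  rw [← cancel_mono (ρ_ V).hom]
  simp only [Category.assoc, Iso.inv_hom_id, Category.comp_id]
  rw [← tensorAction_rightUnitor, ← tensorAction_leftUnitor]
  simp

lemma assoc_whiskerLeft_equivariant {a : H ⊗ M ⟶ M} {b : H ⊗ V ⟶ V} {c : H ⊗ W ⟶ W} {Z : B}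
    {d : H ⊗ Z ⟶ Z} {f : V ⊗ W ⟶ Z} (hf : H ◁ f ≫ d = tensorAction b c ≫ f) :
    H ◁ ((α_ M V W).hom ≫ M ◁ f) ≫ tensorAction a d =
      tensorAction (tensorAction a b) c ≫ (α_ M V W).hom ≫ M ◁ f := by
  rw [whiskerLeft_comp, Category.assoc, whiskerLeft_equivariant hf,
    ← reassoc_of% tensorAction_associator a b c]

/-- Since Δσ = σ ⊗ σ and braiding with the unit object is trivial, a grouplike element acts factor
by factor. -/
lemma grouplike_tensorAction {σ : 𝟙_ B ⟶ H} (hσ : σ ≫ Δ[H] = (λ_ (𝟙_ B)).inv ≫ (σ ⊗ₘ σ))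
    (a : H ⊗ M ⟶ M) (b : H ⊗ V ⟶ V) :
    (λ_ (M ⊗ V)).inv ≫ σ ▷ (M ⊗ V) ≫ tensorAction a b =
      ((λ_ M).inv ≫ σ ▷ M ≫ a) ⊗ₘ ((λ_ V).inv ≫ σ ▷ V ≫ b) := by
  rw [Iso.inv_comp_eq, tensor_left_unitality, tensorAction, ← comp_whiskerRight_assoc, hσ,
    comp_whiskerRight, Category.assoc, tensorμ_natural_left_assoc]
  simp only [Category.assoc, tensorHom_comp_tensorHom, Iso.hom_inv_id_assoc]

/-- Semi-invariance turns the action of s(h) into the scalar φ(s(h)) = ε(h). -/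
lemma counit_contraction_comp_semiinvariant {s : H ⟶ H} {φ : H ⟶ 𝟙_ B} {c : H ⊗ V ⟶ V}
    {p : V ⟶ W} (hc : c ≫ p = φ ▷ V ≫ (λ_ V).hom ≫ p) (hs : s ≫ φ = ε[H]) (f : M ⟶ V) :
    (ε[H] ▷ M ≫ (λ_ M).hom) ≫ f ≫ p = (H ◁ f ≫ s ▷ V ≫ c) ≫ p := by
  simp only [Category.assoc]
  rw [hc, ← comp_whiskerRight_assoc, hs, whisker_exchange_assoc,
    leftUnitor_naturality_assoc]

end Equivariance

/-! ### Tensor powers of H and the coinvariant projection -/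

section DiagonalAction

variable (H : B) [HopfObj H] (δ : H ⟶ 𝟙_ B) (σ : 𝟙_ B ⟶ H)

lemma one_diagonalAction (n : ℕ) :
    η[H] ▷ tensorPow H n ≫ diagonalAction H n = (λ_ (tensorPow H n)).hom := by
  induction n with
  | zero => exact one_counitAction
  | succ n ih => exact one_tensorAction (MonObj.one_mul H) ih

lemma mul_diagonalAction (n : ℕ) :
    μ[H] ▷ tensorPow H n ≫ diagonalAction H n =
      (α_ H H (tensorPow H n)).hom ≫ H ◁ diagonalAction H n ≫ diagonalAction H n := by
  induction n with
  | zero => exact mul_counitAction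
  | succ n ih => exact mul_tensorAction (MonObj.mul_assoc H) ih

/-- The bound keeps only the cofaces built from Δ; the outer two insert u and σ and need not be
H-linear. -/
lemma coface_equivariant (n i : ℕ) (hi : i + 1 ≤ n) :
    H ◁ coface H σ n (i + 1) ≫ diagonalAction H (n + 1) =
      diagonalAction H n ≫ coface H σ n (i + 1) := by
  induction n generalizing i with
  | zero => omega
  | succ n ih =>
    match i with
    | 0 => exact comul_insertion_equivariant _
    | i + 1 => exact whiskerLeft_equivariant (ih i (by omega))

lemma codegeneracy_equivariant (n j : ℕ) (hj : j ≤ n) :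
    H ◁ codegeneracy H n j ≫ diagonalAction H n =
      diagonalAction H (n + 1) ≫ codegeneracy H n j := by
  induction n generalizing j with
  | zero =>
    obtain rfl : j = 0 := by omega
    exact counit_contraction_equivariant _
  | succ n ih =>
    match j with
    | 0 => exact counit_contraction_equivariant _
    | j + 1 => exact whiskerLeft_equivariant (ih j (by omega))

lemma snoc_equivariant (n : ℕ) :
    H ◁ snoc H n ≫ diagonalAction H (n + 1) =
      tensorAction (diagonalAction H n) μ[H] ≫ snoc H n := by
  induction n with
  | zero => exact unit_swap_equivariant _
  | succ n ih => exact assoc_whiskerLeft_equivariant ih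

/-- The projection `h ⊗ x ↦ S̃(h) x` from `H^{⊗ (n + 1)}` to its `δ`-coinvariants `H^{⊗ n}`. -/
def coinvariantProjection (n : ℕ) : H ⊗ tensorPow H n ⟶ tensorPow H n :=
  twistedAntipode H δ ▷ tensorPow H n ≫ diagonalAction H n

lemma paracocyclic_succ (n : ℕ) : paracocyclic H δ σ (n + 1) =
    H ◁ insertLast H σ n ≫ coinvariantProjection H δ (n + 1) := by
  rw [paracocyclic, coinvariantProjection]
  exact (congrArg (· ≫ _) (MonoidalCategory.tensorHom_def' _ _)).trans (Category.assoc _ _ _)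

variable {H δ σ}

/-- In degree 0, where τ is the identity by definition, the formula reads ε(S(σ)) = ε(σ) = 1. -/
lemma paracocyclic_eq (h : IsModularPair H δ σ) (n : ℕ) :
    paracocyclic H δ σ n = insertLast H σ n ≫ coinvariantProjection H δ n := by
  cases n with
  | zero =>
    have : (ρ_ (𝟙_ B)).inv ≫ σ ▷ 𝟙_ B ≫ twistedAntipode H δ ▷ 𝟙_ B ≫ ε[H] ▷ 𝟙_ B ≫
        (λ_ (𝟙_ B)).hom = 𝟙 (𝟙_ B) := by
      rw [← comp_whiskerRight_assoc, ← comp_whiskerRight_assoc, grouplike_twistedAntipode h,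
        Category.assoc, HopfObj.antipode_counit, h.grouplike_counit]
      monoidal
    refine Eq.trans ?_ (this.symm.trans (Category.assoc _ _ _).symm)
    rfl
  | succ n => exact paracocyclic_succ H δ σ n

lemma diagonalAction_comp_coinvariantProjection (h : IsModularPair H δ σ) (n : ℕ) :
    diagonalAction H (n + 1) ≫ coinvariantProjection H δ n =
      δ ▷ tensorPow H (n + 1) ≫ (λ_ (tensorPow H (n + 1))).hom ≫ coinvariantProjection H δ n :=
  tensorAction_comp_antiaction (mul_twistedAntipode h.mul_character)
    twistedAntipode_convolution (one_diagonalAction H n) (mul_diagonalAction H n)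

lemma coface_zero_comp_coinvariantProjection (h : IsModularPair H δ σ) (n : ℕ) :
    coface H σ n 0 ≫ coinvariantProjection H δ n = 𝟙 (tensorPow H n) := by
  have : ((λ_ (tensorPow H n)).inv ≫ η[H] ▷ tensorPow H n) ≫ coinvariantProjection H δ n =
      𝟙 (tensorPow H n) := by
    rw [coinvariantProjection, Category.assoc, ← comp_whiskerRight_assoc,
      one_twistedAntipode h.one_character, one_diagonalAction, Iso.inv_hom_id]
  rw [coface_zero]
  exact this

/-- An equivariant morphism commutes with the projections to the coinvariants. -/
lemma coinvariantProjection_naturality {n m : ℕ} {f : tensorPow H n ⟶ tensorPow H m}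
    (hf : H ◁ f ≫ diagonalAction H m = diagonalAction H n ≫ f) :
    H ◁ f ≫ coinvariantProjection H δ m = coinvariantProjection H δ n ≫ f := by
  rw [coinvariantProjection, coinvariantProjection, whisker_exchange_assoc, hf, Category.assoc]

/-! ### The relations between the cocyclic operators, the cofaces and the codegeneracies -/

lemma coface_zero_comp_paracocyclic (h : IsModularPair H δ σ) (n : ℕ) :
    coface H σ n 0 ≫ paracocyclic H δ σ (n + 1) = coface H σ n (n + 1) := by
  rw [paracocyclic_succ, coface_last]
  have h₁ := coface_zero_naturality H σ (insertLast H σ n)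
  have h₂ := coface_zero_comp_coinvariantProjection h (n + 1)
  calc _ = (coface H σ n 0 ≫ H ◁ insertLast H σ n) ≫ coinvariantProjection H δ (n + 1) :=
        (Category.assoc _ _ _).symm
    _ = (insertLast H σ n ≫ coface H σ (n + 1) 0) ≫ coinvariantProjection H δ (n + 1) := by
        exact congrArg (· ≫ _) h₁
    _ = insertLast H σ n ≫ 𝟙 _ := by
        exact (Category.assoc _ _ _).trans (congrArg (_ ≫ ·) h₂)
    _ = _ := Category.comp_id _

/-- An operator that avoids the first factor passes the insertion of σ, becoming `g`, and then the
projection by equivariance. -/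
lemma whiskerLeft_comp_paracocyclic {n m : ℕ} {f : tensorPow H n ⟶ tensorPow H m}
    {g : tensorPow H (n + 1) ⟶ tensorPow H (m + 1)}
    (hf : H ◁ g ≫ diagonalAction H (m + 1) = diagonalAction H (n + 1) ≫ g)
    (hg : f ≫ insertLast H σ m = insertLast H σ n ≫ g) :
    H ◁ f ≫ paracocyclic H δ σ (m + 1) = paracocyclic H δ σ (n + 1) ≫ g := by
  rw [paracocyclic_succ, paracocyclic_succ]
  calc _ = (H ◁ f ≫ H ◁ insertLast H σ m) ≫ coinvariantProjection H δ (m + 1) :=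
        (Category.assoc _ _ _).symm
    _ = H ◁ insertLast H σ n ≫ H ◁ g ≫ coinvariantProjection H δ (m + 1) := by
        rw [whiskerLeft_comp_eq_comp H hg, Category.assoc]
    _ = H ◁ insertLast H σ n ≫ coinvariantProjection H δ (n + 1) ≫ g :=
        congrArg (_ ≫ ·) (coinvariantProjection_naturality hf)
    _ = _ := (Category.assoc _ _ _).symm

lemma coface_comp_paracocyclic (h : IsModularPair H δ σ) (n i : ℕ) (hi : i ≤ n) :
    coface H σ n (i + 1) ≫ paracocyclic H δ σ (n + 1) = paracocyclic H δ σ n ≫ coface H σ n i := by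
  match n, i with
  -- Here δ_1 inserts σ, and Δσ = σ ⊗ σ brings the composite into the form treated by
  -- `comul_comp_antiaction`.
  | 0, 0 =>
    have h₁ := comul_comp_antiaction (twistedAntipode_convolution (δ := δ))
      (one_counitAction (H := H)) (mul_counitAction (H := H))
    have h₂ : ((ρ_ (𝟙_ B)).inv ≫ σ ▷ 𝟙_ B) ≫ H ◁ ((ρ_ (𝟙_ B)).inv ≫ σ ▷ 𝟙_ B) ≫
        twistedAntipode H δ ▷ (H ⊗ 𝟙_ B) ≫
          tensorAction μ[H] (ε[H] ▷ 𝟙_ B ≫ (λ_ (𝟙_ B)).hom) =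
        𝟙 _ ≫ (λ_ (𝟙_ B)).inv ≫ η[H] ▷ 𝟙_ B := by
      rw [← Category.assoc, grouplike_insertion_comul H h.grouplike_comul, Category.assoc, h₁,
        ← twistedAntipode_eq, Category.assoc, ← comp_whiskerRight_assoc,
        grouplike_twistedAntipode h, Category.assoc, ← comp_whiskerRight_assoc,
        Category.assoc, HopfObj.antipode_counit, h.grouplike_counit]
      monoidal
    rw [paracocyclic_succ]
    exact h₂
  -- S̃(h₁)·(h₂ ⊗ x) = 1 ⊗ S̃(h)·x, with σ already appended to x.
  | n + 1, 0 =>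
    have h₁ := comul_comp_antiaction (V := tensorPow H (n + 1)) (b := diagonalAction H (n + 1))
      (twistedAntipode_convolution (δ := δ)) (one_diagonalAction H (n + 1))
      (mul_diagonalAction H (n + 1))
    have h₂ : (Δ[H] ▷ tensorPow H n ≫ (α_ H H (tensorPow H n)).hom) ≫
        H ◁ H ◁ insertLast H σ n ≫ twistedAntipode H δ ▷ (H ⊗ tensorPow H (n + 1)) ≫
          tensorAction μ[H] (diagonalAction H (n + 1)) =
        (H ◁ insertLast H σ n ≫ (leftTranslation δ ≫ 𝒮[H]) ▷ tensorPow H (n + 1) ≫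
          diagonalAction H (n + 1)) ≫ (λ_ (tensorPow H (n + 1))).inv ≫
            η[H] ▷ tensorPow H (n + 1) := by
      rw [← Category.assoc, comul_insertion_naturality, Category.assoc, h₁]
      simp only [Category.assoc]
    rw [paracocyclic_succ, paracocyclic_succ, coface_zero, coinvariantProjection,
      coinvariantProjection, twistedAntipode_eq]
    rw [twistedAntipode_eq] at h₂
    exact h₂
  | n + 1, i + 1 =>
    refine whiskerLeft_comp_paracocyclic (coface_equivariant H σ _ _ (by omega)) ?_
    rw [← coface_last, ← coface_last]
    exact coface_comp_coface H h.grouplike_comul n (i + 1) (n + 1) (by omega) le_rfl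

lemma codegeneracy_comp_paracocyclic (n i : ℕ) (hi : i + 1 ≤ n) :
    codegeneracy H n (i + 1) ≫ paracocyclic H δ σ n =
      paracocyclic H δ σ (n + 1) ≫ codegeneracy H n i := by
  match n with
  | n + 1 =>
    refine whiskerLeft_comp_paracocyclic (codegeneracy_equivariant H _ _ (by omega)) ?_
    rw [← coface_last, ← coface_last]
    exact (coface_comp_codegeneracy_of_gt H σ n n i (by omega) le_rfl).symm

/-- The last codegeneracy is H-linear, so it passes the projection and kills the inserted σ. -/
lemma paracocyclic_comp_codegeneracy_last (h : IsModularPair H δ σ) (n : ℕ) :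
    paracocyclic H δ σ (n + 1) ≫ codegeneracy H n n = coinvariantProjection H δ n := by
  have h₁ := coface_comp_codegeneracy_succ H h.grouplike_counit n n le_rfl
  rw [coface_last] at h₁
  rw [paracocyclic_succ]
  calc _ = H ◁ insertLast H σ n ≫ coinvariantProjection H δ (n + 1) ≫ codegeneracy H n n :=
        Category.assoc _ _ _
    _ = H ◁ insertLast H σ n ≫ H ◁ codegeneracy H n n ≫ coinvariantProjection H δ n :=
        congrArg (_ ≫ ·) (coinvariantProjection_naturality
          (codegeneracy_equivariant H n n le_rfl)).symm
    _ = 𝟙 _ ≫ coinvariantProjection H δ n := by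
        rw [← whiskerLeft_comp_assoc, h₁, whiskerLeft_id]
    _ = _ := Category.id_comp _

lemma codegeneracy_zero_comp_paracocyclic (h : IsModularPair H δ σ) (n : ℕ) :
    codegeneracy H n 0 ≫ paracocyclic H δ σ n =
      paracocyclic H δ σ (n + 1) ≫ paracocyclic H δ σ (n + 1) ≫ codegeneracy H n n := by
  rw [paracocyclic_comp_codegeneracy_last h, codegeneracy_zero, paracocyclic_eq h,
    paracocyclic_succ]
  exact counit_contraction_comp_semiinvariant (diagonalAction_comp_coinvariantProjection h n)
    (twistedAntipode_character h) _

end DiagonalAction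

end ConnesMoscovici

namespace ConnesMoscovici

variable {B : Type u} [Category.{v} B]

/-! ### Concatenation and rotation of tensor powers -/

section Iterate

/-- The `m`-fold composite of an endomorphism. -/
def iter {X : B} (t : X ⟶ X) : ℕ → (X ⟶ X)
  | 0 => 𝟙 X
  | m + 1 => iter t m ≫ t

lemma iter_succ' {X : B} (t : X ⟶ X) (m : ℕ) : iter t (m + 1) = t ≫ iter t m := by
  induction m with
  | zero => simp [iter]
  | succ m ih => exact (congrArg (· ≫ t) ih).trans (Category.assoc _ _ _)

lemma iter_naturality {X Y : B} {t : X ⟶ X} {t' : Y ⟶ Y} {f : X ⟶ Y} (h : f ≫ t' = t ≫ f)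
    (m : ℕ) : f ≫ iter t' m = iter t m ≫ f := by
  induction m with
  | zero => simp [iter]
  | succ m ih => rw [iter, reassoc_of% ih, h, iter, Category.assoc]

lemma grouplike_comp_semiinvariant {B : Type u} [Category.{v} B] [MonoidalCategory B]
    {H V W : B} {σ : 𝟙_ B ⟶ H} {φ : H ⟶ 𝟙_ B} {c : H ⊗ V ⟶ V} {p : V ⟶ W}
    (hc : c ≫ p = φ ▷ V ≫ (λ_ V).hom ≫ p) (hσ : σ ≫ φ = 𝟙 (𝟙_ B)) :
    ((λ_ V).inv ≫ σ ▷ V ≫ c) ≫ p = p := by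
  rw [Category.assoc, Category.assoc, hc, ← comp_whiskerRight_assoc, hσ]
  simp

/-- Used with `c` = δ_0, `p` the coinvariant projection, `t` = τ_n^{n+1}, `r` the iterated rotation,
`y` and `x` components of θ, and `g` the action of σ. -/
lemma eq_of_retract {B : Type u} [Category.{v} B] {X Y : B} {c : X ⟶ Y}
    {p : Y ⟶ X} {t x : X ⟶ X} {r y g : Y ⟶ Y}
    (hcp : c ≫ p = 𝟙 X) (ht : p ≫ t = r ≫ p) (hr : r = y ≫ g) (hg : g ≫ p = p)
    (hy : c ≫ y = x ≫ c) : t = x := by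
  rw [← Category.id_comp t, ← hcp, Category.assoc, ht, hr, Category.assoc, hg, reassoc_of% hy, hcp,
    Category.comp_id]

end Iterate

variable [MonoidalCategory B]

section Concat

lemma whiskerRight_comp_assoc_whiskerLeft {H X Y Z W V : B} {s : X ⊗ V ⟶ Y} {c : Y ⊗ Z ⟶ W}
    {c' : X ⊗ V ⊗ Z ⟶ W} (h : s ▷ Z ≫ c = (α_ X V Z).hom ≫ c') :
    ((α_ H X V).hom ≫ H ◁ s) ▷ Z ≫ (α_ H Y Z).hom ≫ H ◁ c =
      (α_ (H ⊗ X) V Z).hom ≫ (α_ H X (V ⊗ Z)).hom ≫ H ◁ c' := by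
  calc _ = 𝟙 _ ⊗≫ H ◁ (s ▷ Z ≫ c) := by monoidal
    _ = _ := by rw [h]; monoidal

variable (H : B)

/-- The canonical morphism `H^{⊗ k} ⊗ H^{⊗ m} ⟶ H^{⊗ N}` for `m + k = N`. -/
def concat : (k m N : ℕ) → m + k = N → (tensorPow H k ⊗ tensorPow H m ⟶ tensorPow H N)
  | 0, m, _, h => (λ_ (tensorPow H m)).hom ≫ eqToHom (congrArg (tensorPow H) h)
  | k + 1, m, N + 1, h =>
    (α_ H (tensorPow H k) (tensorPow H m)).hom ≫ H ◁ concat k m N (Nat.succ.inj h)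

lemma concat_zero_left (m : ℕ) : concat H 0 m m rfl = (λ_ (tensorPow H m)).hom :=
  Category.comp_id _

lemma concat_zero_right (k : ℕ) : concat H k 0 k (Nat.zero_add k) = (ρ_ (tensorPow H k)).hom := by
  induction k with
  | zero => exact (concat_zero_left H 0).trans unitors_equal
  | succ k ih =>
    exact (congrArg (_ ≫ H ◁ ·) ih).trans (rightUnitor_tensor_hom _ _).symm

lemma snoc_comp_concat (k m N : ℕ) (h : m + 1 + k = N) :
    snoc H m ▷ tensorPow H k ≫ concat H (m + 1) k N (by omega) =
      (α_ (tensorPow H m) H (tensorPow H k)).hom ≫ concat H m (k + 1) N (by omega) := by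
  induction m generalizing N with
  | zero =>
    obtain rfl : k + 1 = N := by omega
    have : ∀ X : B, ((λ_ H).hom ≫ (ρ_ H).inv) ▷ X ≫ (α_ H (𝟙_ B) X).hom ≫ H ◁ (λ_ X).hom =
        (α_ (𝟙_ B) H X).hom ≫ (λ_ (H ⊗ X)).hom := by
      intro X; monoidal
    rw [concat_zero_left]
    refine Eq.trans ?_ (this (tensorPow H k))
    rw [← concat_zero_left]
    rfl
  | succ m ih =>
    obtain ⟨N, rfl⟩ : ∃ N', N = N' + 1 := ⟨N - 1, by omega⟩
    exact whiskerRight_comp_assoc_whiskerLeft (ih N (by omega))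

lemma concat_comp_snoc (k m N : ℕ) (h : m + k = N) :
    concat H k m N h ▷ H ≫ snoc H N =
      (α_ (tensorPow H k) (tensorPow H m) H).hom ≫ tensorPow H k ◁ snoc H m ≫
        concat H k (m + 1) (N + 1) (by omega) := by
  induction k generalizing N with
  | zero =>
    subst h
    have : ∀ {X Y : B} (s : X ⊗ H ⟶ Y), (λ_ X).hom ▷ H ≫ s =
        (α_ (𝟙_ B) X H).hom ≫ 𝟙_ B ◁ s ≫ (λ_ Y).hom := by
      intro X Y s; simp
    have := this (snoc H m)
    rwa [← concat_zero_left, ← concat_zero_left] at this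
  | succ k ih =>
    obtain ⟨N, rfl⟩ : ∃ N', N = N' + 1 := ⟨N - 1, by omega⟩
    have h' : concat H k m N (Nat.succ.inj h) ▷ H ≫ snoc H N =
        (α_ (tensorPow H k) (tensorPow H m) H).hom ≫ tensorPow H k ◁ snoc H m ≫
          concat H k (m + 1) (N + 1) (by omega) := ih N (by omega)
    refine (whiskerRight_comp_assoc_whiskerLeft h').trans ?_
    refine congrArg (_ ≫ ·) ?_
    have : ∀ {X Y Z W : B} (s : Y ⟶ Z) (c : X ⊗ Z ⟶ W),
        (α_ H X Y).hom ≫ H ◁ (X ◁ s ≫ c) = (H ⊗ X) ◁ s ≫ (α_ H X Z).hom ≫ H ◁ c := by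
      intros; simp
    exact this _ _

end Concat

variable [BraidedCategory B]

section Rotation

/-- By the hexagon, moving X and then Y to the end differs from moving X ⊗ Y as a block by the
double braiding of X and Y, the same term as in the twist axiom. -/
lemma braiding_double_rotation {X Y Z : B} (f : X ⟶ X) (g : Y ⟶ Y) :
    (α_ X Y Z).hom ≫ f ▷ (Y ⊗ Z) ≫ (β_ X (Y ⊗ Z)).hom ≫ (α_ Y Z X).hom ≫
      g ▷ (Z ⊗ X) ≫ (β_ Y (Z ⊗ X)).hom ≫ (α_ Z X Y).hom =
    ((β_ X Y).hom ≫ (β_ Y X).hom ≫ (f ⊗ₘ g)) ▷ Z ≫ (β_ (X ⊗ Y) Z).hom := by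
  calc _ = ((α_ X Y Z).hom ≫ (β_ X (Y ⊗ Z)).hom ≫ (α_ Y Z X).hom) ≫
          (β_ Y (Z ⊗ X)).hom ≫ (α_ Z X Y).hom ≫ Z ◁ (f ⊗ₘ g) := by
        simp only [BraidedCategory.braiding_naturality_left_assoc, Category.assoc,
          tensor_whiskerLeft, Iso.inv_hom_id_assoc,
          MonoidalCategory.tensorHom_def, whiskerLeft_comp,
          BraidedCategory.braiding_naturality_right_assoc, associator_naturality_middle_assoc,
          Iso.inv_hom_id, Category.comp_id]
    _ = (β_ X Y).hom ▷ Z ≫ (α_ Y X Z).hom ≫ (β_ Y (X ⊗ Z)).hom ≫ (β_ X Z).hom ▷ Y ≫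
          (α_ Z X Y).hom ≫ Z ◁ (f ⊗ₘ g) := by
        rw [BraidedCategory.hexagon_forward, Category.assoc, Category.assoc,
          BraidedCategory.braiding_naturality_right_assoc]
    _ = ((β_ X Y).hom ≫ (β_ Y X).hom) ▷ Z ≫ (β_ (X ⊗ Y) Z).hom ≫ Z ◁ (f ⊗ₘ g) := by
        rw [BraidedCategory.braiding_tensor_left_hom, BraidedCategory.braiding_tensor_right_hom]
        simp
    _ = _ := by
        rw [← BraidedCategory.braiding_naturality_left]
        simp only [comp_whiskerRight, Category.assoc]

lemma rotation_step {H K M N M' Q : B} {c : K ⊗ M ⟶ N} {s : N ⊗ H ⟶ Q} {s' : M ⊗ H ⟶ M'}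
    {c' : K ⊗ M' ⟶ Q} {d' : M' ⊗ K ⟶ Q} {d : M ⊗ H ⊗ K ⟶ Q} {t : Q ⟶ Q} {f : H ⟶ H} {g : K ⟶ K}
    (hc : c ▷ H ≫ s = (α_ K M H).hom ≫ K ◁ s' ≫ c') (hd : s' ▷ K ≫ d' = (α_ M H K).hom ≫ d)
    (ht : c' ≫ t = g ▷ M' ≫ (β_ K M').hom ≫ d') :
    ((α_ H K M).hom ≫ H ◁ c) ≫ (f ▷ N ≫ (β_ H N).hom ≫ s) ≫ t =
      ((β_ H K).hom ≫ (β_ K H).hom ≫ (f ⊗ₘ g)) ▷ M ≫ (β_ (H ⊗ K) M).hom ≫ d := by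
  calc _ = (α_ H K M).hom ≫ f ▷ (K ⊗ M) ≫ (β_ H (K ⊗ M)).hom ≫ (c ▷ H ≫ s) ≫ t := by
        simp only [Category.assoc, whisker_exchange_assoc,
          BraidedCategory.braiding_naturality_right_assoc]
    _ = (α_ H K M).hom ≫ f ▷ (K ⊗ M) ≫ (β_ H (K ⊗ M)).hom ≫ (α_ K M H).hom ≫
          g ▷ (M ⊗ H) ≫ (β_ K (M ⊗ H)).hom ≫ s' ▷ K ≫ d' := by
        rw [hc, Category.assoc, Category.assoc, ht, whisker_exchange_assoc,
          BraidedCategory.braiding_naturality_right_assoc]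
    _ = _ := by
        rw [hd, ← reassoc_of% braiding_double_rotation f g]

/-- Cyclic rotation of `H^{⊗ (n + 1)}`, with `f` applied to the factor that moves. -/
def rotation {H : B} (f : H ⟶ H) (n : ℕ) : H ⊗ tensorPow H n ⟶ tensorPow H (n + 1) :=
  f ▷ tensorPow H n ≫ (β_ H (tensorPow H n)).hom ≫ snoc H n

variable {H : B} {f : H ⟶ H} {F : (n : ℕ) → (tensorPow H n ⟶ tensorPow H n)}

/-- After k rotations the first k factors have crossed the other m as a block, and `F k` records
their self-braiding and the copies of `f`. The induction varies m because the first rotation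
lengthens the right-hand block. -/
lemma concat_comp_iter_rotation (hF₀ : F 0 = 𝟙 _)
    (hF : ∀ n, F (n + 1) = (β_ H (tensorPow H n)).hom ≫ (β_ (tensorPow H n) H).hom ≫ (f ⊗ₘ F n))
    (N k m : ℕ) (h : m + k = N + 1) :
    concat H k m (N + 1) h ≫ iter (rotation f N) k =
      F k ▷ tensorPow H m ≫ (β_ (tensorPow H k) (tensorPow H m)).hom ≫
        concat H m k (N + 1) (by omega) := by
  induction k generalizing m with
  | zero =>
    obtain rfl : m = N + 1 := by omega
    have : concat H 0 (N + 1) (N + 1) rfl = (β_ (𝟙_ B) (tensorPow H (N + 1))).hom ≫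
        concat H (N + 1) 0 (N + 1) (Nat.zero_add _) := by
      rw [concat_zero_left, concat_zero_right]
      exact (braiding_rightUnitor _).symm
    rw [hF₀, id_whiskerRight, Category.id_comp]
    exact (Category.comp_id _).trans this
  | succ k ih =>
    have key := rotation_step (f := f) (concat_comp_snoc H k m N (by omega))
      (snoc_comp_concat H k m (N + 1) (by omega)) (ih (m + 1) (by omega))
    rw [← hF] at key
    exact (congrArg (_ ≫ ·) (iter_succ' _ k)).trans key

lemma iter_rotation (hF₀ : F 0 = 𝟙 _)
    (hF : ∀ n, F (n + 1) = (β_ H (tensorPow H n)).hom ≫ (β_ (tensorPow H n) H).hom ≫ (f ⊗ₘ F n))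
    (N : ℕ) : iter (rotation f N) (N + 1) = F (N + 1) := by
  have := concat_comp_iter_rotation hF₀ hF N (N + 1) 0 (by omega)
  rw [concat_zero_right, concat_zero_left] at this
  have h : F (N + 1) ▷ 𝟙_ B ≫ (β_ (tensorPow H (N + 1)) (𝟙_ B)).hom ≫
      (λ_ (tensorPow H (N + 1))).hom = (ρ_ (tensorPow H (N + 1))).hom ≫ F (N + 1) := by
    rw [braiding_leftUnitor, rightUnitor_naturality]
  exact (cancel_epi (ρ_ (tensorPow H (N + 1))).hom).1 (this.trans h)

end Rotation

end ConnesMoscovici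

/-! ### The twist on the unit object -/

variable {B : Type u} [Category.{v} B] [MonoidalCategory B] [BraidedCategory B]

namespace BraidedTwist

variable (θ : BraidedTwist B)

lemma app_naturality {X Y : B} (f : X ⟶ Y) : f ≫ θ.app Y = θ.app X ≫ f :=
  θ.iso.hom.naturality f

lemma app_tensorObj (X Y : B) : θ.app (X ⊗ Y) =
    (β_ X Y).hom ≫ (β_ Y X).hom ≫ (θ.app X ⊗ₘ θ.app Y) := θ.app_tensor X Y

/-- Braidings with the unit object are trivial, so the twist axiom makes this component idempotent;
it is also invertible. -/
lemma app_tensorUnit : θ.app (𝟙_ B) = 𝟙 (𝟙_ B) := by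
  have : IsIso (θ.app (𝟙_ B)) := inferInstanceAs (IsIso (θ.iso.hom.app (𝟙_ B)))
  have h := θ.app_naturality (λ_ (𝟙_ B)).hom
  rw [app_tensorObj, braiding_tensorUnit_left, unitors_equal, Iso.hom_inv_id, Category.id_comp,
    Category.id_comp, MonoidalCategory.tensorHom_def', Category.assoc, rightUnitor_naturality,
    ← unitors_equal, leftUnitor_naturality_assoc] at h
  rw [cancel_epi] at h
  exact ((cancel_epi (θ.app (𝟙_ B))).1 (h.symm.trans (Category.comp_id _).symm))

lemma comp_app_of_tensorUnit {X : B} (f : 𝟙_ B ⟶ X) : f ≫ θ.app X = f := by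
  rw [app_naturality, app_tensorUnit, Category.id_comp]

lemma app_comp_of_tensorUnit {X : B} (f : X ⟶ 𝟙_ B) : θ.app X ≫ f = f := by
  rw [← app_naturality, app_tensorUnit, Category.comp_id]

end BraidedTwist

/-! ### Powers of the paracocyclic operator -/

namespace ConnesMoscovici

section Cyclicity

variable {H : B} [HopfObj H] {δ : H ⟶ 𝟙_ B} {σ : 𝟙_ B ⟶ H}

lemma skipAction_grouplike (M : B) :
    H ◁ ((ρ_ M).inv ≫ M ◁ σ) ≫ skipAction M μ[H] = (β_ H M).hom ≫ M ◁ rightMul σ := by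
  calc _ = 𝟙 _ ⊗≫ ((H ⊗ M) ◁ σ ≫ (β_ H M).hom ▷ H) ⊗≫ M ◁ μ[H] := by
        rw [skipAction]; monoidal
    _ = _ := by rw [whisker_exchange, rightMul]; monoidal

/-- With g = s(h), untwisting gives gm ⊗ σ = g₁·(m ⊗ S(g₂)σ) up to braiding, and `p` turns g₁ into
φ(g₁). What remains is φ(g₁)S(g₂)σ in the last place; for s = S̃ and φ = δ it is S̃²(h)σ. -/
lemma antiaction_comp_insertion_comp_semiinvariant {M N : B} {s : H ⟶ H} {φ : H ⟶ 𝟙_ B}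
    {a : H ⊗ M ⟶ M} {c : H ⊗ N ⟶ N} {i : M ⊗ H ⟶ N} {p : N ⟶ M}
    (hi : H ◁ i ≫ c = tensorAction a μ[H] ≫ i) (hc : c ≫ p = φ ▷ N ≫ (λ_ N).hom ≫ p) :
    s ▷ M ≫ a ≫ ((ρ_ M).inv ≫ M ◁ σ ≫ i) ≫ p =
      (s ≫ (leftTranslation φ ≫ 𝒮[H]) ≫ rightMul σ) ▷ M ≫ (β_ H M).hom ≫ i ≫ p := by
  calc _ = s ▷ M ≫ H ◁ ((ρ_ M).inv ≫ M ◁ σ) ≫ ((α_ H M H).inv ≫ a ▷ H) ≫ i ≫ p := by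
        calc _ = s ▷ M ≫ ((ρ_ _).inv ≫ a ▷ 𝟙_ B ≫ M ◁ σ) ≫ i ≫ p := by
              rw [← rightUnitor_inv_naturality_assoc]; simp only [Category.assoc]
          _ = _ := by rw [← whisker_exchange]; monoidal
    _ = s ▷ M ≫ H ◁ ((ρ_ M).inv ≫ M ◁ σ) ≫ Δ[H] ▷ (M ⊗ H) ≫ (α_ H H (M ⊗ H)).hom ≫
          H ◁ (𝒮[H] ▷ (M ⊗ H) ≫ skipAction M μ[H] ≫ i) ≫ φ ▷ N ≫ (λ_ N).hom ≫ p := by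
        rw [whiskerRight_action_eq a (MonObj.one_mul H) (MonObj.mul_assoc H)]
        simp only [Category.assoc, whiskerLeft_comp]
        rw [← reassoc_of% hi, hc]
    _ = s ▷ M ≫ H ◁ ((ρ_ M).inv ≫ M ◁ σ) ≫ (leftTranslation φ ≫ 𝒮[H]) ▷ (M ⊗ H) ≫
          skipAction M μ[H] ≫ i ≫ p := by
        rw [whisker_exchange_assoc φ, leftUnitor_naturality_assoc, leftTranslation]
        monoidal
    _ = (s ≫ leftTranslation φ ≫ 𝒮[H]) ▷ M ≫ (H ◁ ((ρ_ M).inv ≫ M ◁ σ) ≫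
          skipAction M μ[H]) ≫ i ≫ p := by
        rw [whisker_exchange_assoc]
        monoidal
    _ = _ := by
        rw [skipAction_grouplike, Category.assoc,
          ← BraidedCategory.braiding_naturality_left_assoc]
        simp only [comp_whiskerRight, Category.assoc]

lemma coinvariantProjection_comp_paracocyclic {θ : BraidedTwist B}
    (h : IsTwistedModularPairInInvolution θ H δ σ) (n : ℕ) :
    coinvariantProjection H δ n ≫ paracocyclic H δ σ n =
      rotation (θ.app H ≫ leftMul σ) n ≫ coinvariantProjection H δ n := by
  have key := antiaction_comp_insertion_comp_semiinvariant (σ := σ) (s := twistedAntipode H δ)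
    (snoc_equivariant H n) (diagonalAction_comp_coinvariantProjection h.toIsModularPair n)
  rw [← twistedAntipode_eq, twistedAntipode_sq h] at key
  rw [paracocyclic_eq h.toIsModularPair, insertLast_eq, rotation]
  refine Eq.trans ?_ (key.trans ?_)
  · rw [coinvariantProjection]; exact Category.assoc _ _ _
  · exact ((Category.assoc _ _ _).trans (congrArg (_ ≫ ·) (Category.assoc _ _ _))).symm

/-- The action of the grouplike element `σ` on `H^{⊗ n}`. -/
def grouplikeAction (σ : 𝟙_ B ⟶ H) (n : ℕ) : tensorPow H n ⟶ tensorPow H n :=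
  (λ_ (tensorPow H n)).inv ≫ σ ▷ tensorPow H n ≫ diagonalAction H n

/-- The family θ followed by the σ-action satisfies the recursion of `iter_rotation`: the twist
axiom supplies the double braiding, and σ acts factor by factor. -/
lemma iter_rotation_twist (θ : BraidedTwist B) (h : IsModularPair H δ σ) (n : ℕ) :
    iter (rotation (θ.app H ≫ leftMul σ) n) (n + 1) =
      θ.app (tensorPow H (n + 1)) ≫ grouplikeAction σ (n + 1) := by
  refine iter_rotation (F := fun n ↦ θ.app (tensorPow H n) ≫ grouplikeAction σ n) ?_ ?_ n
  · have : θ.app (𝟙_ B) ≫ (λ_ (𝟙_ B)).inv ≫ σ ▷ 𝟙_ B ≫ ε[H] ▷ 𝟙_ B ≫ (λ_ (𝟙_ B)).hom =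
        𝟙 (𝟙_ B) := by
      rw [θ.app_tensorUnit, ← comp_whiskerRight_assoc, h.grouplike_counit]
      simp
    exact this
  · intro n
    have h₁ : grouplikeAction σ (n + 1) = leftMul σ ⊗ₘ grouplikeAction σ n :=
      grouplike_tensorAction h.grouplike_comul μ[H] (diagonalAction H n)
    have h₂ := θ.app_tensorObj H (tensorPow H n)
    rw [← tensorHom_comp_tensorHom]
    refine (congrArg₂ (· ≫ ·) h₂ h₁).trans ?_
    exact (Category.assoc _ _ _).trans (congrArg (_ ≫ ·) (Category.assoc _ _ _))

lemma iter_paracocyclic {θ : BraidedTwist B} (h : IsTwistedModularPairInInvolution θ H δ σ)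
    (n : ℕ) : iter (paracocyclic H δ σ n) (n + 1) = θ.app (tensorPow H n) := by
  have hm := h.toIsModularPair
  exact eq_of_retract (coface_zero_comp_coinvariantProjection hm n)
    (iter_naturality (coinvariantProjection_comp_paracocyclic h n) (n + 1))
    (iter_rotation_twist θ hm n)
    (grouplike_comp_semiinvariant (diagonalAction_comp_coinvariantProjection hm n)
      hm.grouplike_character)
    (θ.app_naturality (coface H σ n 0))

end Cyclicity

/-! ### The cocyclic module and the cyclic module -/

section Functor

variable {H : B} [HopfObj H] {δ : H ⟶ 𝟙_ B} {σ : 𝟙_ B ⟶ H}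

lemma lift_map_tPow (n m : ℕ) : (Paths.lift (CM H δ σ)).map (CyclicQuiver.tPow n m) =
    iter (paracocyclic H δ σ n) m := by
  induction m with
  | zero => rfl
  | succ m ih =>
    refine Eq.trans ((Paths.lift (CM H δ σ)).map_comp _ _) ?_
    exact congrArg₂ (· ≫ ·) ih (Paths.lift_toPath _ _)

lemma lift_map_d (n i : ℕ) (hi : i ≤ n + 1) :
    (Paths.lift (CM H δ σ)).map (CyclicQuiver.d n i hi) = coface H σ n i :=
  Paths.lift_toPath _ _

lemma lift_map_s (n j : ℕ) (hj : j ≤ n) :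
    (Paths.lift (CM H δ σ)).map (CyclicQuiver.s n j hj) = codegeneracy H n j :=
  Paths.lift_toPath _ _

lemma lift_map_t (n : ℕ) :
    (Paths.lift (CM H δ σ)).map (CyclicQuiver.t n) = paracocyclic H δ σ n :=
  Paths.lift_toPath _ _

lemma lift_map_comp {x y z : Paths CyclicQuiver} {f : x ⟶ y} {g : y ⟶ z}
    {f' : (Paths.lift (CM H δ σ)).obj x ⟶ (Paths.lift (CM H δ σ)).obj y}
    {g' : (Paths.lift (CM H δ σ)).obj y ⟶ (Paths.lift (CM H δ σ)).obj z}
    (hf : (Paths.lift (CM H δ σ)).map f = f') (hg : (Paths.lift (CM H δ σ)).map g = g') :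
    (Paths.lift (CM H δ σ)).map (f ≫ g) = f' ≫ g' := by
  rw [Functor.map_comp, hf, hg]

/-- The second alternative serves only the cyclicity relation, which holds in `B` up to θ. -/
lemma lift_map_eq_of_rel {θ : BraidedTwist B} (h : IsTwistedModularPairInInvolution θ H δ σ)
    {x y : Paths CyclicQuiver} {f g : x ⟶ y} (r : CyclicQuiver.Rel f g) :
    (Paths.lift (CM H δ σ)).map f = (Paths.lift (CM H δ σ)).map g ∨
      (Paths.lift (CM H δ σ)).map f = (Paths.lift (CM H δ σ)).map g ≫ θ.app _ := by
  have hm := h.toIsModularPair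
  cases r with
  | coface_coface n i j hij hj =>
    obtain ⟨j, rfl⟩ : ∃ j', j = j' + 1 := ⟨j - 1, by omega⟩
    exact .inl <| (lift_map_comp (lift_map_d _ _ _) (lift_map_d _ _ _)).trans <|
      (coface_comp_coface H hm.grouplike_comul n i j (by omega) (by omega)).trans
        (lift_map_comp (lift_map_d _ _ _) (lift_map_d _ _ _)).symm
  | codegeneracy_codegeneracy n i j hij hj =>
    exact .inl <| (lift_map_comp (lift_map_s _ _ _) (lift_map_s _ _ _)).trans <|
      (codegeneracy_comp_codegeneracy H n i j hij hj).trans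
        (lift_map_comp (lift_map_s _ _ _) (lift_map_s _ _ _)).symm
  | coface_codegeneracy_of_lt n i j hij hj =>
    obtain ⟨j, rfl⟩ : ∃ j', j = j' + 1 := ⟨j - 1, by omega⟩
    exact .inl <| (lift_map_comp (lift_map_d _ _ _) (lift_map_s _ _ _)).trans <|
      (coface_comp_codegeneracy_of_le H σ n i j (by omega) (by omega)).trans
        (lift_map_comp (lift_map_s _ _ _) (lift_map_d _ _ _)).symm
  | coface_codegeneracy_self n j hj =>
    exact .inl <| (lift_map_comp (lift_map_d _ _ _) (lift_map_s _ _ _)).trans <|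
      (coface_comp_codegeneracy_self H σ n j hj).trans
        ((Paths.lift (CM H δ σ)).map_id _).symm
  | coface_codegeneracy_succ n j hj =>
    exact .inl <| (lift_map_comp (lift_map_d _ _ _) (lift_map_s _ _ _)).trans <|
      (coface_comp_codegeneracy_succ H hm.grouplike_counit n j hj).trans
        ((Paths.lift (CM H δ σ)).map_id _).symm
  | coface_codegeneracy_of_gt n i j hij hi =>
    obtain ⟨i, rfl⟩ : ∃ i', i = i' + 2 := ⟨i - 2, by omega⟩
    exact .inl <| (lift_map_comp (lift_map_d _ _ _) (lift_map_s _ _ _)).trans <|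
      (coface_comp_codegeneracy_of_gt H σ n i j (by omega) (by omega)).trans
        (lift_map_comp (lift_map_s _ _ _) (lift_map_d _ _ _)).symm
  | coface_cocyclic n i hi hi' =>
    obtain ⟨i, rfl⟩ : ∃ i', i = i' + 1 := ⟨i - 1, by omega⟩
    exact .inl <| (lift_map_comp (lift_map_d _ _ _) (lift_map_t _)).trans <|
      (coface_comp_paracocyclic hm n i (by omega)).trans
        (lift_map_comp (lift_map_t _) (lift_map_d _ _ _)).symm
  | coface_zero_cocyclic n =>
    exact .inl <| (lift_map_comp (lift_map_d _ _ _) (lift_map_t _)).trans <|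
      (coface_zero_comp_paracocyclic hm n).trans (lift_map_d _ _ _).symm
  | codegeneracy_cocyclic n i hi hi' =>
    obtain ⟨i, rfl⟩ : ∃ i', i = i' + 1 := ⟨i - 1, by omega⟩
    exact .inl <| (lift_map_comp (lift_map_s _ _ _) (lift_map_t _)).trans <|
      (codegeneracy_comp_paracocyclic n i (by omega)).trans
        (lift_map_comp (lift_map_t _) (lift_map_s _ _ _)).symm
  | codegeneracy_zero_cocyclic n =>
    exact .inl <| (lift_map_comp (lift_map_s _ _ _) (lift_map_t _)).trans <|
      (codegeneracy_zero_comp_paracocyclic hm n).trans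
        (lift_map_comp (lift_map_t _) (lift_map_comp (lift_map_t _) (lift_map_s _ _ _))).symm
  | cocyclic_pow n =>
    refine .inr <| (lift_map_tPow n (n + 1)).trans <| (iter_paracocyclic h n).trans ?_
    exact ((congrArg (· ≫ θ.app _) ((Paths.lift (CM H δ σ)).map_id _)).trans
      (Category.id_comp _)).symm

/-- A functor that sends the twist to identities sends `CM(H, δ, σ)` to a cocyclic object. -/
lemma isCocyclicObject_CM_comp {θ : BraidedTwist B} (h : IsTwistedModularPairInInvolution θ H δ σ)
    {C : Type*} [Category* C] (W : B ⥤ C) (hW : ∀ X, W.map (θ.app X) = 𝟙 (W.obj X)) :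
    IsCocyclicObject (CM H δ σ ⋙q W.toPrefunctor) := by
  let G := Paths.lift (CM H δ σ) ⋙ W
  have hG : ∀ (x y : Paths CyclicQuiver) (f g : x ⟶ y), CyclicQuiver.Rel f g →
      G.map f = G.map g := by
    intro x y f g r
    rcases lift_map_eq_of_rel h r with e | e
    · exact congrArg W.map e
    · refine (congrArg W.map e).trans ((W.map_comp _ _).trans ?_)
      rw [hW, Category.comp_id]
      rfl
  refine ⟨CategoryTheory.Quotient.lift _ G hG, ?_⟩
  calc _ = Paths.of CyclicQuiver ⋙q (CategoryTheory.Quotient.functor CyclicQuiver.Rel ⋙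
          CategoryTheory.Quotient.lift _ G hG).toPrefunctor := rfl
    _ = (Paths.of CyclicQuiver ⋙q (Paths.lift (CM H δ σ)).toPrefunctor) ⋙q W.toPrefunctor := by
        rw [CategoryTheory.Quotient.lift_spec]; rfl
    _ = _ := by rw [Paths.lift_spec]

end Functor

end ConnesMoscovici

theorem mainTheorem5 (k : Type w) [CommRing k] (B : Type u) [Category.{v} B] [Preadditive B]
    [Linear k B] [MonoidalCategory B] [MonoidalPreadditive B] [MonoidalLinear k B]
    [BraidedCategory B] (θ : BraidedTwist B) (H : B) [HopfObj H] [IsIso 𝒮[H]]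
    (δ : H ⟶ 𝟙_ B) (σ : 𝟙_ B ⟶ H) (h : IsTwistedModularPairInInvolution θ H δ σ) :
    IsCocyclicObject (homFromUnit k (ConnesMoscovici.CM H δ σ)) ∧
      IsCyclicObject (homToUnit k (ConnesMoscovici.CM H δ σ)) := by
  refine ⟨ConnesMoscovici.isCocyclicObject_CM_comp h _ fun X ↦ ?_, ?_⟩
  · ext f
    exact θ.comp_app_of_tensorUnit f
  -- The contravariant functor Hom(-, 𝟙) is treated as a covariant one into the opposite of modules;
  -- a cocyclic object there is a cyclic module.
  · obtain ⟨Y, hY⟩ := ConnesMoscovici.isCocyclicObject_CM_comp h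
      ((linearYoneda k B).obj (𝟙_ B)).rightOp fun X ↦ by
        refine Quiver.Hom.unop_inj ?_
        ext f
        exact θ.app_comp_of_tensorUnit f
    exact ⟨Y.leftOp, hY⟩
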